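/- **Proposition 5.2 (governing equation of the mixture tempered time-fractional Poisson process).** Let $c_1,c_2\ge 0$ with $c_1+c_2=1$, let $\alpha_1,\alpha_2\in(0,1)$, $\lambda_1,\lambda_2\ge 0$ and $\mu>0$. Let $S$ be a mixture of tempered stable subordinators (MTSS), i.e. a nondecreasing Lévy process with $$\mathbb E\,e^{-sS(t)}=\exp\Big(-t\sum_{i=1}^2 c_i\big((s+\lambda_i)^{\alpha_i}-\lambda_i^{\alpha_i}\big)\Big),\qquad s>0,\ t\ge 0,$$ let $E(t)=\inf\{u>0: S(u)>t\}$ be its right-continuous inverse, let $N$ be a homogeneous Poisson process of intensity $\mu$ independent of $S$, and put $Y(t)=N(E(t))$ and $p_\mu(k,t)=\mathbb P(Y(t)=k)$. For $\nu\in(0,1)$ and $c\ge 0$ let the shifted fractional derivative be $$\Big(c+\frac{\partial}{\partial t}\Big)^{\nu} f(t)=e^{-ct}\,\frac{d}{dt}\,\frac{1}{\Gamma(1-\nu)}\int_0^t (t-u)^{-\nu}\big(e^{cu}f(u)-f(0)\big)\,du ,$$ whose Laplace transform is $(c+s)^\nu \tilde f(s)-(c+s)^{\nu-1}f(0)$,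 and let $M^{r}_{p,q}(z)=\sum_{n\ge 0}\frac{\Gamma(r+n)}{\Gamma(r)\,\Gamma(pn+q)}\frac{z^n}{n!}$ be the Prabhakar function. Then for every integer $k\ge 1$ and every $t>0$ the derivatives $\big(\lambda_i+\frac{\partial}{\partial t}\big)^{\alpha_i}p_\mu(k,t)$, $i=1,2$, exist (the defining integrals converge and the outer derivatives exist), and $$\sum_{i=1}^2 c_i\Big(\lambda_i+\frac{\partial}{\partial t}\Big)^{\alpha_i}p_\mu(k,t) =-\mu\big[p_\mu(k,t)-p_\mu(k-1,t)\big]+\big[c_1\lambda_1^{\alpha_1}+c_2\lambda_2^{\alpha_2}\big]p_\mu(k,t) -\sum_{i=1}^2 c_i\,t^{-\alpha_i}M^{1-\alpha_i}_{1,1-\alpha_i}(-\lambda_i t)\,\langle\delta,\,p(k,\cdot)\rangle .$$ Here $p(k,x)=e^{-\mu x}(\mu x)^k/k!$ is the probability mass function of the Poisson process, $\delta$ is the Dirac mass at $0$ in the space variable $x$, and $\langle\delta,p(k,\cdot)\rangle=\int p(k,x)\,\delta(dx)=p(k,0)$. (For $k\ge 1$ this number is $0$, so the source terms vanish.) -/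

import Mathlib

open MeasureTheory ProbabilityTheory Filter Topology
open scoped NNReal

noncomputable section

namespace MTTFPP

/-! ### Lévy processes, subordinators, Poisson processes -/

/-- A path on `[0, ∞)` is càdlàg: right continuous with (finite) left limits. -/
def IsCadlag (x : ℝ≥0 → ℝ) : Prop :=
  ∀ t, ContinuousWithinAt x (Set.Ioi t) t ∧ ∃ l, Tendsto x (𝓝[<] t) (𝓝 l)

/-- A real-valued Lévy process: it starts at `0`, has independent and stationary increments, and
almost all of its paths are càdlàg. -/
structure IsLevyProcess {Ω : Type*} [MeasurableSpace Ω] (X : ℝ≥0 → Ω → ℝ) (P : Measure Ω) :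
    Prop where
  measurable : ∀ t, Measurable (X t)
  zero : ∀ᵐ ω ∂P, X 0 ω = 0
  indep : HasIndepIncrements X P
  stationary : ∀ s h : ℝ≥0, IdentDistrib (fun ω => X (s + h) ω - X s ω) (X h) P P
  cadlag : ∀ᵐ ω ∂P, IsCadlag (fun t => X t ω)

/-- A subordinator: a Lévy process with nondecreasing paths. -/
structure IsSubordinator {Ω : Type*} [MeasurableSpace Ω] (X : ℝ≥0 → Ω → ℝ) (P : Measure Ω) :
    Prop extends IsLevyProcess X P where
  monotone : ∀ᵐ ω ∂P, Monotone (fun t => X t ω)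

/-- A homogeneous Poisson process of intensity `μ`: an `ℕ`-valued Lévy process whose value at
time `t` has the Poisson law of parameter `μ t`. -/
structure IsPoissonProcess {Ω : Type*} [MeasurableSpace Ω] (N : ℝ≥0 → Ω → ℕ) (μ : ℝ≥0)
    (P : Measure Ω) : Prop where
  levy : IsLevyProcess (fun t ω => (N t ω : ℝ)) P
  law : ∀ t, HasLaw (N t) (poissonMeasure (μ * t)) P

/-! ### The mixture of tempered stable subordinators and its inverse -/

/-- The Laplace exponent
`φ(s) = c₁ ((s + λ₁)^α₁ - λ₁^α₁) + c₂ ((s + λ₂)^α₂ - λ₂^α₂)`. -/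
def laplaceExponent (c₁ c₂ α₁ α₂ l₁ l₂ s : ℝ) : ℝ :=
  c₁ * ((s + l₁) ^ α₁ - l₁ ^ α₁) + c₂ * ((s + l₂) ^ α₂ - l₂ ^ α₂)

/-- A mixture of tempered stable subordinators: a subordinator `S` with
`𝔼 exp(-s S(t)) = exp(-t φ(s))` for `s > 0`. -/
structure IsMTSS {Ω : Type*} [MeasurableSpace Ω] (S : ℝ≥0 → Ω → ℝ)
    (c₁ c₂ α₁ α₂ l₁ l₂ : ℝ) (P : Measure Ω) : Prop extends IsSubordinator S P where
  laplace : ∀ (t : ℝ≥0) (s : ℝ), 0 < s →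
    ∫ ω, Real.exp (-(s * S t ω)) ∂P
      = Real.exp (-((t : ℝ) * laplaceExponent c₁ c₂ α₁ α₂ l₁ l₂ s))

/-- The right continuous inverse `E(t) = inf {u > 0 : S(u) > t}`. -/
def inverseProcess {Ω : Type*} (S : ℝ≥0 → Ω → ℝ) (t : ℝ) (ω : Ω) : ℝ≥0 :=
  sInf {u : ℝ≥0 | 0 < u ∧ t < S u ω}

/-- The probability mass function `p(k, t) = P(N(E(t)) = k)` of the time-changed process. -/
def timeChangedPMF {Ω : Type*} [MeasurableSpace Ω] (N : ℝ≥0 → Ω → ℕ) (S : ℝ≥0 → Ω → ℝ)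
    (P : Measure Ω) (k : ℕ) (t : ℝ) : ℝ :=
  P.real {ω | N (inverseProcess S t ω) ω = k}

/-- The probability mass function at `k` of a Poisson process of intensity `μ` at time `u`. -/
def poissonProb (μ : ℝ) (k : ℕ) (u : ℝ) : ℝ :=
  Real.exp (-(μ * u)) * (μ * u) ^ k / (k.factorial : ℝ)

/-! ### Shifted fractional derivatives and the Prabhakar function -/

/-- The fractional integral of order `1 - ν` of `f - f(0)`,
`(1 / Γ(1 - ν)) ∫₀ᵗ (t - u)^(-ν) (f(u) - f(0)) du`. -/
def fracIntegral (ν : ℝ) (f : ℝ → ℝ) (t : ℝ) : ℝ :=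
  (Real.Gamma (1 - ν))⁻¹ * ∫ u in (0 : ℝ)..t, (t - u) ^ (-ν) * (f u - f 0)

/-- The fractional derivative of order `ν ∈ (0, 1)`, normalised by the initial value: the
Riemann-Liouville derivative of `f - f(0)`. Its Laplace transform is
`s ^ ν * F(s) - s ^ (ν - 1) * f(0)`, where `F` is that of `f`. -/
def fracDeriv (ν : ℝ) (f : ℝ → ℝ) (t : ℝ) : ℝ :=
  deriv (fracIntegral ν f) t

/-- The shifted fractional derivative `(c + d/dt)^ν f = e^(-ct) (d/dt)^ν (e^(ct) f)`. Its Laplace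
transform is `(c + s) ^ ν * F(s) - (c + s) ^ (ν - 1) * f(0)`. -/
def shiftedFracDeriv (c ν : ℝ) (f : ℝ → ℝ) (t : ℝ) : ℝ :=
  Real.exp (-(c * t)) * fracDeriv ν (fun u => Real.exp (c * u) * f u) t

/-- The shifted fractional derivative of `f` exists at `t` in the proper sense: the integrals
in its definition converge and the outer derivative exists. -/
def ShiftedFracDifferentiableAt (c ν : ℝ) (f : ℝ → ℝ) (t : ℝ) : Prop :=
  (∀ τ, 0 ≤ τ → IntervalIntegrable
    (fun u => (τ - u) ^ (-ν) * (Real.exp (c * u) * f u - f 0)) volume 0 τ) ∧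
  DifferentiableAt ℝ (fracIntegral ν (fun u => Real.exp (c * u) * f u)) t

/-- The Prabhakar (three-parameter Mittag-Leffler) function
`M^r_{p,q}(z) = ∑ₙ (r)ₙ / Γ(p n + q) * zⁿ / n!`, where `(r)ₙ = Γ(r + n) / Γ(r)`. -/
def prabhakar (r p q z : ℝ) : ℝ :=
  ∑' n : ℕ, (Real.Gamma (r + n) / Real.Gamma r) / Real.Gamma (p * n + q)
    * (z ^ n / (n.factorial : ℝ))

/-- The source term `t^(-α) M^{1-α}_{1,1-α}(-λ t) δ`, paired with a function `w` of the space
variable `x` on which the Dirac mass `δ` at `0` acts. -/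
def sourceTerm (α l t : ℝ) (w : ℝ → ℝ) : ℝ :=
  t ^ (-α) * prabhakar (1 - α) 1 (1 - α) (-(l * t)) * ∫ x, w x ∂(Measure.dirac (0 : ℝ))

end MTTFPP

end

/-! Write Q_m(t) = P(N(E(t)) ≥ m), so that p_k = Q_k - Q_{k+1}. By independence, Q_m(t) is the mean
of a Poisson tail at E(t), and for m ≥ 1 that tail is the integral of an Erlang density over 0 < y <
E(t). For fixed y and a fixed path, y < E(t) means t > S(y), up to the single value t = S(y).
Tonelli and E exp(-s S(y)) = exp(-y φ(s)) then give Q_m the Laplace transform s⁻¹ ρ^m with ρ = μ /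
(μ + φ(s)) (`IsMTSS.lintegral_mixedTail`). The relation (μ + φ) ρ = μ is the governing equation in
transform space: φ L[p_k] = -μ (L[p_k] - L[p_{k-1}]). Here p_k(0) = 0, so the shifted derivatives
formally act as multiplication by (s + λ_i)^α_i.

Going back to a pointwise equation requires regularity of p_k. On vertical lines the transform of
Q_m is only known to be O(|s|^(-1 - min α)), too slow for a C¹ inverse. One derivative in s gains a
factor |s|⁻¹ and corresponds to multiplication by t, so t Q_m(t) extends to a C¹ function by Fourier
inversion (`exists_contDiff_eq_mul_tail`). Inversion only speaks at continuity points, and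
monotonicity of Q_m carries the conclusion to every t > 0. Control of t p_k(t) suffices to
differentiate the weakly singular integrals (`differentiableAt_integral_sub_rpow_mul`).

Finally, the fractional derivatives are never Laplace transformed. Their primitive and that of the
right-hand side are shown to have the same transform, hence to coincide, and are then differentiated
(`governing_equation_of_tails`). -/

namespace MTTFPP

/-! ### Laplace transforms on half-planes: holomorphy, uniqueness, inversion -/

/-- The (complex) Laplace transform of a real function on the half-line. -/
noncomputable def laplaceTransform (g : ℝ → ℝ) (s : ℂ) : ℂ :=
  ∫ t in Set.Ioi (0 : ℝ), Complex.exp (-(s * t)) * (g t : ℂ)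

lemma laplaceTransform_ofReal (g : ℝ → ℝ) (s : ℝ) :
    laplaceTransform g s = ((∫ t in Set.Ioi (0 : ℝ), Real.exp (-(s * t)) * g t : ℝ) : ℂ) := by
  rw [← integral_complex_ofReal]
  simp [laplaceTransform]

lemma aestronglyMeasurable_of_integrableOn_exp_mul {g : ℝ → ℝ} {b : ℝ}
    (hg : IntegrableOn (fun t => Real.exp (-(b * t)) * g t) (Set.Ioi 0)) :
    AEStronglyMeasurable g (volume.restrict (Set.Ioi 0)) := by
  have h : AEStronglyMeasurable (fun t : ℝ => Real.exp (b * t) * (Real.exp (-(b * t)) * g t))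
      (volume.restrict (Set.Ioi 0)) :=
    (by fun_prop : Continuous fun t : ℝ => Real.exp (b * t)).aestronglyMeasurable.mul
      hg.aestronglyMeasurable
  refine h.congr (ae_of_all _ fun t => ?_)
  simp only [← mul_assoc, ← Real.exp_add]
  simp

lemma integrableOn_cexp_mul {g : ℝ → ℝ} {b : ℝ} {s : ℂ}
    (hg : IntegrableOn (fun t => Real.exp (-(b * t)) * g t) (Set.Ioi 0)) (hs : b ≤ s.re) :
    IntegrableOn (fun t : ℝ => Complex.exp (-(s * t)) * (g t : ℂ)) (Set.Ioi 0) := by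
  have hm := aestronglyMeasurable_of_integrableOn_exp_mul hg
  refine Integrable.mono hg ?_ ?_
  · exact (by fun_prop : Continuous fun t : ℝ => Complex.exp (-(s * t))).aestronglyMeasurable.mul
      (Complex.continuous_ofReal.comp_aestronglyMeasurable hm)
  · filter_upwards [ae_restrict_mem measurableSet_Ioi] with t ht
    have ht : 0 < t := ht
    simp only [norm_mul, Complex.norm_exp, Complex.norm_real, Real.norm_eq_abs, Real.abs_exp]
    gcongr
    simp
    gcongr

lemma integrableOn_exp_mul_of_le {g : ℝ → ℝ} {b c : ℝ}
    (hg : IntegrableOn (fun t => Real.exp (-(b * t)) * g t) (Set.Ioi 0)) (hs : b ≤ c) :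
    IntegrableOn (fun t : ℝ => Real.exp (-(c * t)) * g t) (Set.Ioi 0) := by
  have := (integrableOn_cexp_mul (s := c) hg (by simpa using hs)).re
  refine this.congr (ae_of_all _ fun t => ?_)
  have : Complex.exp (-((c : ℂ) * t)) * (g t : ℂ) = ((Real.exp (-(c * t)) * g t : ℝ) : ℂ) := by
    push_cast; rfl
  simp only [this]
  exact Complex.ofReal_re _

lemma mul_exp_neg_mul_le {ε t : ℝ} (hε : 0 < ε) : t * Real.exp (-(ε * t)) ≤ 1 / ε := by
  have h := Real.add_one_le_exp (ε * t)
  rw [Real.exp_neg, ← div_eq_mul_inv, div_le_div_iff₀ (Real.exp_pos _) hε]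
  linarith

lemma integrableOn_exp_mul_id_mul {g : ℝ → ℝ} {b c : ℝ}
    (hg : IntegrableOn (fun t => Real.exp (-(b * t)) * g t) (Set.Ioi 0)) (hs : b < c) :
    IntegrableOn (fun t : ℝ => Real.exp (-(c * t)) * (t * g t)) (Set.Ioi 0) := by
  have hm := aestronglyMeasurable_of_integrableOn_exp_mul hg
  refine Integrable.mono (hg.const_mul (1 / (c - b))) ?_ ?_
  · exact (by fun_prop : Continuous fun t : ℝ => Real.exp (-(c * t))).aestronglyMeasurable.mul
      (continuous_id.aestronglyMeasurable.mul hm)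
  · filter_upwards [ae_restrict_mem measurableSet_Ioi] with t ht
    have ht : 0 < t := ht
    have hcb : 0 < c - b := by linarith
    simp only [norm_mul, Real.norm_eq_abs, Real.abs_exp, abs_of_pos ht,
      abs_of_pos (one_div_pos.mpr hcb)]
    have h1 := mul_exp_neg_mul_le (t := t) hcb
    have h2 : Real.exp (-(c * t)) = Real.exp (-((c - b) * t)) * Real.exp (-(b * t)) := by
      rw [← Real.exp_add]; ring_nf
    calc Real.exp (-(c * t)) * (t * |g t|)
        = (t * Real.exp (-((c - b) * t))) * (Real.exp (-(b * t)) * |g t|) := by rw [h2]; ring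
      _ ≤ _ := by gcongr

/-- Differentiation under the integral. On the ball of radius ε = (Re s - b) / 2 all real parts
exceed b + ε, and the factor t produced by the derivative is absorbed by exp(-ε t). -/
lemma hasDerivAt_laplaceTransform {g : ℝ → ℝ} {b : ℝ} {s : ℂ}
    (hg : IntegrableOn (fun t => Real.exp (-(b * t)) * g t) (Set.Ioi 0)) (hs : b < s.re) :
    HasDerivAt (laplaceTransform g) (-laplaceTransform (fun t => t * g t) s) s := by
  set ε := (s.re - b) / 2 with hε
  have hε0 : 0 < ε := by rw [hε]; linarith
  have hm := aestronglyMeasurable_of_integrableOn_exp_mul hg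
  have hmc : AEStronglyMeasurable (fun t => (g t : ℂ)) (volume.restrict (Set.Ioi 0)) :=
    Complex.continuous_ofReal.comp_aestronglyMeasurable hm
  have key := hasDerivAt_integral_of_dominated_loc_of_deriv_le (μ := volume.restrict (Set.Ioi 0))
    (F := fun (z : ℂ) (t : ℝ) => Complex.exp (-(z * t)) * (g t : ℂ))
    (F' := fun (z : ℂ) (t : ℝ) => Complex.exp (-(z * t)) * (-(t : ℂ)) * (g t : ℂ))
    (bound := fun t => ‖Real.exp (-((b + ε) * t)) * (t * g t)‖) (x₀ := s)
    (Metric.ball_mem_nhds s hε0) ?_ ?_ ?_ ?_ ?_ ?_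
  · have h := key.2
    convert! h using 1
    rw [laplaceTransform, ← integral_neg]
    congr 1; ext t; push_cast; ring
  · exact Eventually.of_forall fun z =>
      (by fun_prop : Continuous fun t : ℝ => Complex.exp (-(z * t))).aestronglyMeasurable.mul hmc
  · exact integrableOn_cexp_mul hg hs.le
  · exact (by fun_prop : Continuous fun t : ℝ =>
      Complex.exp (-(s * t)) * (-(t : ℂ))).aestronglyMeasurable.mul hmc
  · filter_upwards [ae_restrict_mem measurableSet_Ioi] with t ht z hz
    have ht : 0 < t := ht
    have hz' : b + ε ≤ z.re := by
      have h1 : |(z - s).re| ≤ ‖z - s‖ := Complex.abs_re_le_norm _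
      rw [Metric.mem_ball, dist_eq_norm] at hz
      have := (abs_le.mp h1).1
      simp at this
      linarith
    simp only [norm_mul, norm_neg, Complex.norm_exp, Complex.norm_real, Real.norm_eq_abs,
      Real.abs_exp, mul_assoc]
    gcongr
    simp
    gcongr
  · exact (integrableOn_exp_mul_id_mul hg (by linarith)).norm
  · exact ae_of_all _ fun t z _ => by
      have h1 : HasDerivAt (fun z : ℂ => -(z * (t : ℂ))) (-(t : ℂ)) z := by
        have := ((hasDerivAt_id z).mul_const (t : ℂ)).neg
        rwa [one_mul] at this
      exact h1.cexp.mul_const _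

/-- Identity theorem: both functions are analytic on the connected half-plane and agree at real
points accumulating at b + 1. -/
lemma eqOn_laplaceTransform {g : ℝ → ℝ} {b : ℝ} {F : ℂ → ℂ}
    (hg : IntegrableOn (fun t => Real.exp (-(b * t)) * g t) (Set.Ioi 0))
    (hF : DifferentiableOn ℂ F {s | b < s.re})
    (h : ∀ s : ℝ, b < s → laplaceTransform g s = F s) :
    Set.EqOn (laplaceTransform g) F {s | b < s.re} := by
  have hop : IsOpen {s : ℂ | b < s.re} := isOpen_lt continuous_const Complex.continuous_re
  have hL : DifferentiableOn ℂ (laplaceTransform g) {s | b < s.re} := fun s hs =>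
    (hasDerivAt_laplaceTransform hg hs).differentiableAt.differentiableWithinAt
  have hmem : ((b + 1 : ℝ) : ℂ) ∈ {s : ℂ | b < s.re} := by
    show b < ((b + 1 : ℝ) : ℂ).re
    rw [Complex.ofReal_re]; linarith
  refine AnalyticOnNhd.eqOn_of_preconnected_of_frequently_eq (hL.analyticOnNhd hop)
    (hF.analyticOnNhd hop) (convex_halfSpace_re_gt b).isPreconnected hmem ?_
  have ht : Tendsto (fun n : ℕ => (((b + 1) + 1 / ((n : ℝ) + 1) : ℝ) : ℂ)) atTop
      (𝓝[≠] ((b + 1 : ℝ) : ℂ)) := by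
    refine tendsto_nhdsWithin_iff.mpr ⟨?_, Eventually.of_forall fun n => ?_⟩
    · refine (Complex.continuous_ofReal.tendsto _).comp ?_
      simpa using (tendsto_one_div_add_atTop_nhds_zero_nat (𝕜 := ℝ)).const_add (b + 1)
    · simp only [Set.mem_compl_iff, Set.mem_singleton_iff, Complex.ofReal_inj]
      have : 0 < 1 / ((n : ℝ) + 1) := by positivity
      linarith
  refine ht.frequently (Eventually.frequently (Eventually.of_forall fun n => ?_))
  have : 0 < 1 / ((n : ℝ) + 1) := by positivity
  exact h _ (by linarith)

-- On the line Re s = a the Laplace transform is the Fourier transform of the damped function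
-- extended by zero. The factor 2π comes from the normalisation of `𝓕`.
open FourierTransform in
lemma fourier_indicator_exp_mul (g : ℝ → ℝ) (a ξ : ℝ) :
    𝓕 ((Set.Ioi (0 : ℝ)).indicator fun t => ((Real.exp (-(a * t)) * g t : ℝ) : ℂ)) ξ
      = laplaceTransform g (a + 2 * Real.pi * ξ * Complex.I) := by
  rw [Real.fourier_real_eq_integral_exp_smul, laplaceTransform,
    ← integral_indicator measurableSet_Ioi]
  congr 1; ext t
  by_cases ht : t ∈ Set.Ioi (0 : ℝ)
  · simp only [Set.indicator_of_mem ht, smul_eq_mul]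
    push_cast
    rw [← mul_assoc, ← Complex.exp_add]
    ring_nf
  · simp [Set.indicator_of_notMem ht]

lemma integrable_indicator_exp_mul {g : ℝ → ℝ} {b : ℝ}
    (hg : IntegrableOn (fun t => Real.exp (-(b * t)) * g t) (Set.Ioi 0)) :
    Integrable ((Set.Ioi (0 : ℝ)).indicator fun t => ((Real.exp (-(b * t)) * g t : ℝ) : ℂ)) :=
  IntegrableOn.integrable_indicator (Integrable.ofReal hg) measurableSet_Ioi

lemma continuousAt_indicator_exp_mul {g : ℝ → ℝ} {b t : ℝ} (ht : 0 < t)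
    (hg : ContinuousAt g t) :
    ContinuousAt
      ((Set.Ioi (0 : ℝ)).indicator fun t => ((Real.exp (-(b * t)) * g t : ℝ) : ℂ)) t := by
  have h : ContinuousAt (fun t => ((Real.exp (-(b * t)) * g t : ℝ) : ℂ)) t := by fun_prop
  refine h.congr ?_
  filter_upwards [lt_mem_nhds ht] with u hu
  rw [Set.indicator_of_mem (Set.mem_Ioi.mpr hu)]

open FourierTransform in
/-- Injectivity of the Laplace transform on functions continuous on `(0, ∞)`. -/
lemma eq_zero_of_laplace_eq_zero {g : ℝ → ℝ} {b : ℝ}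
    (hg : IntegrableOn (fun t => Real.exp (-(b * t)) * g t) (Set.Ioi 0))
    (h : ∀ s : ℝ, b < s → ∫ t in Set.Ioi (0 : ℝ), Real.exp (-(s * t)) * g t = 0)
    {t : ℝ} (ht : 0 < t) (hc : ContinuousAt g t) : g t = 0 := by
  have h0 : Set.EqOn (laplaceTransform g) (fun _ => 0) {s | b < s.re} :=
    eqOn_laplaceTransform hg (differentiableOn_const _) fun s hs => by
      rw [laplaceTransform_ofReal, h s hs, Complex.ofReal_zero]
  have hF : 𝓕 ((Set.Ioi (0 : ℝ)).indicator
      fun t => ((Real.exp (-((b + 1) * t)) * g t : ℝ) : ℂ)) = 0 := by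
    ext ξ
    rw [fourier_indicator_exp_mul]
    refine h0 ?_
    simp
  have hI := integrable_indicator_exp_mul
    (integrableOn_exp_mul_of_le hg (by linarith : b ≤ b + 1))
  have := hI.fourierInv_fourier_eq (by rw [hF]; exact integrable_zero _ _ _)
    (continuousAt_indicator_exp_mul ht hc)
  rw [hF, Set.indicator_of_mem (Set.mem_Ioi.mpr ht)] at this
  have h2 : (𝓕⁻ (0 : ℝ → ℂ)) t = 0 := by simp [Real.fourierInv_eq]
  rw [h2] at this
  have := Complex.ofReal_eq_zero.mp this.symm
  simpa [Real.exp_ne_zero] using this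

open FourierTransform in
/-- A function whose Laplace transform decays fast on a vertical line agrees with a `C¹` function
at its points of continuity. -/
lemma exists_contDiff_eq_of_laplaceTransform {g : ℝ → ℝ} {a : ℝ}
    (hg : IntegrableOn (fun t => Real.exp (-(a * t)) * g t) (Set.Ioi 0))
    (h0 : Integrable fun ξ : ℝ => laplaceTransform g (a + 2 * Real.pi * ξ * Complex.I))
    (h1 : Integrable fun ξ : ℝ =>
      |ξ| * ‖laplaceTransform g (a + 2 * Real.pi * ξ * Complex.I)‖) :
    ∃ H : ℝ → ℝ, ContDiff ℝ 1 H ∧ ∀ t, 0 < t → ContinuousAt g t → H t = g t := by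
  set G : ℝ → ℂ := (Set.Ioi (0 : ℝ)).indicator fun t => ((Real.exp (-(a * t)) * g t : ℝ) : ℂ)
    with hG
  have hFG : 𝓕 G = fun ξ : ℝ => laplaceTransform g (a + 2 * Real.pi * ξ * Complex.I) := by
    ext ξ; exact fourier_indicator_exp_mul g a ξ
  have hcd : ContDiff ℝ 1 (𝓕 (𝓕 G)) := by
    have := Real.contDiff_fourier (f := 𝓕 G) (N := 1) (fun n hn => ?_)
    · exact_mod_cast this
    · have hn : n ≤ 1 := by exact_mod_cast hn
      rw [hFG]
      interval_cases n
      · simpa using h0.norm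
      · simpa using h1
  -- Inverse Fourier is Fourier composed with t ↦ -t, and exp(a t) undoes the damping. The zeroth
  -- and first moments of `𝓕 G` make the double transform C¹.
  refine ⟨fun t => Real.exp (a * t) * (𝓕 (𝓕 G) (-t)).re, ?_, fun t ht hc => ?_⟩
  · refine ContDiff.mul (by fun_prop) ?_
    exact Complex.reCLM.contDiff.comp (hcd.comp contDiff_neg)
  · have := (integrable_indicator_exp_mul hg).fourierInv_fourier_eq
      (by rw [← hG, hFG]; exact h0) (continuousAt_indicator_exp_mul ht hc)
    rw [← hG, Real.fourierInv_eq_fourier_neg] at this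
    beta_reduce
    rw [this, hG, Set.indicator_of_mem (Set.mem_Ioi.mpr ht), Complex.ofReal_re, ← mul_assoc,
      ← Real.exp_add]
    simp
/-! ### The Laplace exponent on a half-plane -/

/-- On the closed right half-plane |arg z| ≤ π/2, so α |arg z| ≤ πα/2 < π/2, and the cosine
decreases on [0, π]. -/
lemma cos_mul_norm_rpow_le_re_cpow {z : ℂ} (hz : 0 ≤ z.re) {α : ℝ} (hα : α ∈ Set.Ioo (0 : ℝ) 1) :
    Real.cos (Real.pi / 2 * α) * ‖z‖ ^ α ≤ (z ^ (α : ℂ)).re := by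
  rw [Complex.cpow_ofReal_re, mul_comm]
  have h := Complex.abs_arg_le_pi_div_two_iff.mpr hz
  have hpi := Real.pi_pos
  refine mul_le_mul_of_nonneg_left ?_ (Real.rpow_nonneg (norm_nonneg _) _)
  rw [← Real.cos_abs (z.arg * α), abs_mul, abs_of_pos hα.1]
  refine Real.cos_le_cos_of_nonneg_of_le_pi (mul_nonneg (abs_nonneg _) hα.1.le) ?_ ?_
  · nlinarith [hα.1, hα.2]
  · exact mul_le_mul_of_nonneg_right h hα.1.le

/-- Half of the cosine bound is kept; for large |z| the other half absorbs the constant l^α. -/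
lemma exists_half_cos_mul_norm_rpow_le {α : ℝ} (hα : α ∈ Set.Ioo (0 : ℝ) 1) (l : ℝ) :
    ∃ κ > 0, ∃ b : ℝ, ∀ z : ℂ, 0 ≤ z.re → b ≤ ‖z‖ →
      κ * ‖z‖ ^ α ≤ (z ^ (α : ℂ)).re - l ^ α := by
  have hpi := Real.pi_pos
  have hcos : 0 < Real.cos (Real.pi / 2 * α) := by
    refine Real.cos_pos_of_mem_Ioo ⟨?_, ?_⟩ <;> nlinarith [hα.1, hα.2]
  obtain ⟨b, hb⟩ := eventually_atTop.mp (((tendsto_rpow_atTop hα.1).const_mul_atTop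
    (half_pos hcos)).eventually_ge_atTop (l ^ α))
  refine ⟨_, half_pos hcos, b, fun z hz hbz => ?_⟩
  have h1 := hb _ hbz
  have h2 := cos_mul_norm_rpow_le_re_cpow hz hα
  linarith

/-- The holomorphic extension of the Laplace exponent to the right half-plane. -/
noncomputable def complexExponent (c₁ c₂ α₁ α₂ l₁ l₂ : ℝ) (s : ℂ) : ℂ :=
  c₁ * ((s + l₁) ^ (α₁ : ℂ) - (l₁ ^ α₁ : ℝ)) + c₂ * ((s + l₂) ^ (α₂ : ℂ) - (l₂ ^ α₂ : ℝ))

lemma complexExponent_ofReal {c₁ c₂ α₁ α₂ l₁ l₂ s : ℝ} (hl₁ : 0 ≤ l₁) (hl₂ : 0 ≤ l₂)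
    (hs : 0 ≤ s) :
    complexExponent c₁ c₂ α₁ α₂ l₁ l₂ s = (laplaceExponent c₁ c₂ α₁ α₂ l₁ l₂ s : ℂ) := by
  rw [complexExponent, laplaceExponent]
  push_cast [Complex.ofReal_cpow (add_nonneg hs hl₁), Complex.ofReal_cpow (add_nonneg hs hl₂)]
  rfl

lemma norm_le_norm_add_ofReal {s : ℂ} (hs : 0 ≤ s.re) {l : ℝ} (hl : 0 ≤ l) :
    ‖s‖ ≤ ‖s + l‖ := by
  rw [Complex.norm_def, Complex.norm_def]
  refine Real.sqrt_le_sqrt ?_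
  simp only [Complex.normSq_apply, Complex.add_re, Complex.ofReal_re, Complex.add_im,
    Complex.ofReal_im, add_zero]
  nlinarith

lemma hasDerivAt_cpow_shift {s : ℂ} (hs : 0 < s.re) {l : ℝ} (hl : 0 ≤ l) (α : ℝ) :
    HasDerivAt (fun z : ℂ => (z + l) ^ (α : ℂ)) (α * (s + l) ^ ((α : ℂ) - 1)) s := by
  have := ((hasDerivAt_id s).add_const (l : ℂ)).cpow_const (c := (α : ℂ))
    (Or.inl (by simp; linarith))
  simpa using this

/-- Differentiating costs one factor |s + l| ≥ |s|. Thus φ' is smaller than the weight of φ by a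
factor |s|⁻¹. -/
lemma norm_cpow_shift_deriv_le {s : ℂ} (hs : 0 < s.re) {l : ℝ} (hl : 0 ≤ l) {α : ℝ}
    (hα : α ∈ Set.Ioo (0 : ℝ) 1) :
    ‖α * (s + l) ^ ((α : ℂ) - 1)‖ ≤ ‖s + l‖ ^ α / ‖s‖ := by
  have h0 : 0 < ‖s‖ := lt_of_lt_of_le hs (Complex.re_le_norm s)
  have h1 := norm_le_norm_add_ofReal hs.le hl
  have hne : s + l ≠ 0 := norm_pos_iff.mp (h0.trans_le h1)
  rw [Complex.cpow_sub _ _ hne, Complex.cpow_one, norm_mul, norm_div, Complex.norm_real,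
    Real.norm_of_nonneg hα.1.le, Complex.norm_cpow_of_ne_zero hne]
  simp only [Complex.ofReal_re, Complex.ofReal_im, mul_zero, Real.exp_zero, div_one]
  have h2 : 0 ≤ ‖s + l‖ ^ α := Real.rpow_nonneg (norm_nonneg _) _
  calc α * (‖s + l‖ ^ α / ‖s + l‖) ≤ 1 * (‖s + l‖ ^ α / ‖s‖) := by
        gcongr
        exact hα.2.le
    _ = _ := one_mul _

/-- The weight `c₁ |s + l₁|^α₁ + c₂ |s + l₂|^α₂` controlling the Laplace exponent. -/
noncomputable def exponentWeight (c₁ c₂ α₁ α₂ l₁ l₂ : ℝ) (s : ℂ) : ℝ :=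
  c₁ * ‖s + l₁‖ ^ α₁ + c₂ * ‖s + l₂‖ ^ α₂

section

variable {c₁ c₂ α₁ α₂ l₁ l₂ μ : ℝ}

lemma rpow_min_le_exponentWeight (hc₁ : 0 ≤ c₁) (hc₂ : 0 ≤ c₂) (hc : c₁ + c₂ = 1)
    (hα₁ : α₁ ∈ Set.Ioo (0 : ℝ) 1) (hα₂ : α₂ ∈ Set.Ioo (0 : ℝ) 1) (hl₁ : 0 ≤ l₁) (hl₂ : 0 ≤ l₂)
    {s : ℂ} (hs : 1 ≤ s.re) :
    ‖s‖ ^ (min α₁ α₂) ≤ exponentWeight c₁ c₂ α₁ α₂ l₁ l₂ s := by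
  have h1 : 1 ≤ ‖s‖ := hs.trans (Complex.re_le_norm s)
  have key : ∀ {α l : ℝ}, 0 ≤ l → 0 < α → min α₁ α₂ ≤ α → ‖s‖ ^ (min α₁ α₂) ≤ ‖s + l‖ ^ α :=
    fun {α l} hl hα h => (Real.rpow_le_rpow_of_exponent_le h1 h).trans
      (Real.rpow_le_rpow (norm_nonneg _) (norm_le_norm_add_ofReal (by linarith) hl) hα.le)
  calc ‖s‖ ^ (min α₁ α₂) = c₁ * ‖s‖ ^ (min α₁ α₂) + c₂ * ‖s‖ ^ (min α₁ α₂) := by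
        rw [← add_mul, hc, one_mul]
    _ ≤ _ := add_le_add
        (mul_le_mul_of_nonneg_left (key hl₁ hα₁.1 (min_le_left _ _)) hc₁)
        (mul_le_mul_of_nonneg_left (key hl₂ hα₂.1 (min_le_right _ _)) hc₂)

/-- Taking real parts rules out cancellation between the two powers: each real part is bounded below
separately, once Re s is large. -/
lemma exists_mul_exponentWeight_le (hc₁ : 0 ≤ c₁) (hc₂ : 0 ≤ c₂)
    (hα₁ : α₁ ∈ Set.Ioo (0 : ℝ) 1) (hα₂ : α₂ ∈ Set.Ioo (0 : ℝ) 1) (hl₁ : 0 ≤ l₁) (hl₂ : 0 ≤ l₂)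
    (hμ : 0 < μ) :
    ∃ κ > 0, ∃ a ≥ 1, ∀ s : ℂ, a ≤ s.re →
      κ * exponentWeight c₁ c₂ α₁ α₂ l₁ l₂ s ≤ ‖μ + complexExponent c₁ c₂ α₁ α₂ l₁ l₂ s‖ := by
  obtain ⟨κ₁, hκ₁, b₁, h₁⟩ := exists_half_cos_mul_norm_rpow_le hα₁ l₁
  obtain ⟨κ₂, hκ₂, b₂, h₂⟩ := exists_half_cos_mul_norm_rpow_le hα₂ l₂
  refine ⟨min κ₁ κ₂, lt_min hκ₁ hκ₂, max 1 (max b₁ b₂), le_max_left _ _, fun s hs => ?_⟩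
  have hs1 : 1 ≤ s.re := (le_max_left _ _).trans hs
  have hsb : max b₁ b₂ ≤ ‖s‖ := ((le_max_right _ _).trans hs).trans (Complex.re_le_norm s)
  have e₁ := h₁ (s + l₁) (by simp; linarith)
    (((le_max_left _ _).trans hsb).trans (norm_le_norm_add_ofReal (by linarith) hl₁))
  have e₂ := h₂ (s + l₂) (by simp; linarith)
    (((le_max_right _ _).trans hsb).trans (norm_le_norm_add_ofReal (by linarith) hl₂))
  refine le_trans ?_ (Complex.re_le_norm _)
  have hre : (μ + complexExponent c₁ c₂ α₁ α₂ l₁ l₂ s).re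
      = μ + (c₁ * (((s + l₁) ^ (α₁ : ℂ)).re - l₁ ^ α₁)
        + c₂ * (((s + l₂) ^ (α₂ : ℂ)).re - l₂ ^ α₂)) := by
    rw [complexExponent]
    simp only [Complex.add_re, Complex.re_ofReal_mul, Complex.sub_re, Complex.ofReal_re]
  rw [hre, exponentWeight, mul_add]
  have f₁ : min κ₁ κ₂ * (c₁ * ‖s + l₁‖ ^ α₁) ≤ c₁ * (((s + l₁) ^ (α₁ : ℂ)).re - l₁ ^ α₁) := by
    rw [mul_left_comm]
    refine mul_le_mul_of_nonneg_left (le_trans ?_ e₁) hc₁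
    exact mul_le_mul_of_nonneg_right (min_le_left _ _) (Real.rpow_nonneg (norm_nonneg _) _)
  have f₂ : min κ₁ κ₂ * (c₂ * ‖s + l₂‖ ^ α₂) ≤ c₂ * (((s + l₂) ^ (α₂ : ℂ)).re - l₂ ^ α₂) := by
    rw [mul_left_comm]
    refine mul_le_mul_of_nonneg_left (le_trans ?_ e₂) hc₂
    exact mul_le_mul_of_nonneg_right (min_le_right _ _) (Real.rpow_nonneg (norm_nonneg _) _)
  linarith

lemma exists_hasDerivAt_complexExponent (hc₁ : 0 ≤ c₁) (hc₂ : 0 ≤ c₂)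
    (hα₁ : α₁ ∈ Set.Ioo (0 : ℝ) 1) (hα₂ : α₂ ∈ Set.Ioo (0 : ℝ) 1) (hl₁ : 0 ≤ l₁) (hl₂ : 0 ≤ l₂)
    {s : ℂ} (hs : 0 < s.re) :
    ∃ d : ℂ, HasDerivAt (complexExponent c₁ c₂ α₁ α₂ l₁ l₂) d s ∧
      ‖d‖ ≤ exponentWeight c₁ c₂ α₁ α₂ l₁ l₂ s / ‖s‖ := by
  refine ⟨_, ((((hasDerivAt_cpow_shift hs hl₁ α₁).sub_const _).const_mul (c₁ : ℂ)).add
    (((hasDerivAt_cpow_shift hs hl₂ α₂).sub_const _).const_mul (c₂ : ℂ))), ?_⟩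
  refine (norm_add_le _ _).trans ?_
  rw [exponentWeight, add_div, norm_mul (c₁ : ℂ), norm_mul (c₂ : ℂ), Complex.norm_real,
    Complex.norm_real, Real.norm_of_nonneg hc₁, Real.norm_of_nonneg hc₂, mul_div_assoc,
    mul_div_assoc]
  exact add_le_add (mul_le_mul_of_nonneg_left (norm_cpow_shift_deriv_le hs hl₁ hα₁) hc₁)
    (mul_le_mul_of_nonneg_left (norm_cpow_shift_deriv_le hs hl₂ hα₂) hc₂)

/-! ### Decay of the derivative of the tail transform -/

/-- The Laplace transform `s⁻¹ (μ / (μ + φ(s)))^m` of `P(N(E(t)) ≥ m)`, on complex arguments. -/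
noncomputable def tailTransform (c₁ c₂ α₁ α₂ l₁ l₂ μ : ℝ) (m : ℕ) (s : ℂ) : ℂ :=
  s⁻¹ * (μ / (μ + complexExponent c₁ c₂ α₁ α₂ l₁ l₂ s)) ^ m

/-- The logarithmic derivative -(s⁻¹ + m φ' / (μ + φ)) is O(|s|⁻¹), because |φ'| ≤ W / |s| and |μ +
φ| ≥ κ W for the common weight W. The function itself is O(|s|^(-1 - min α)). -/
lemma exists_hasDerivAt_tailTransform (hc₁ : 0 ≤ c₁) (hc₂ : 0 ≤ c₂) (hc : c₁ + c₂ = 1)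
    (hα₁ : α₁ ∈ Set.Ioo (0 : ℝ) 1) (hα₂ : α₂ ∈ Set.Ioo (0 : ℝ) 1) (hl₁ : 0 ≤ l₁) (hl₂ : 0 ≤ l₂)
    (hμ : 0 < μ) {m : ℕ} (hm : 1 ≤ m) :
    ∃ a ≥ 1, ∃ C : ℝ, ∀ s : ℂ, a ≤ s.re →
      ∃ d : ℂ, HasDerivAt (tailTransform c₁ c₂ α₁ α₂ l₁ l₂ μ m) d s ∧
        ‖d‖ ≤ C * ‖s‖ ^ (-(2 + min α₁ α₂)) := by
  obtain ⟨κ, hκ, a, ha, h⟩ := exists_mul_exponentWeight_le hc₁ hc₂ hα₁ hα₂ hl₁ hl₂ hμ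
  refine ⟨a, ha, (μ / κ) ^ m * (1 + m / κ), fun s hs => ?_⟩
  have hs1 : 1 ≤ s.re := ha.trans hs
  have hn1 : 1 ≤ ‖s‖ := hs1.trans (Complex.re_le_norm s)
  have hn0 : 0 < ‖s‖ := by linarith
  have hs0 : s ≠ 0 := norm_pos_iff.mp hn0
  have hα0 : 0 < min α₁ α₂ := lt_min hα₁.1 hα₂.1
  have hW := rpow_min_le_exponentWeight hc₁ hc₂ hc hα₁ hα₂ hl₁ hl₂ hs1
  have hp : 0 < ‖s‖ ^ (min α₁ α₂) := Real.rpow_pos_of_pos hn0 _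
  have hW0 := hp.trans_le hW
  have hκW := h s hs
  have hd0 : 0 < ‖μ + complexExponent c₁ c₂ α₁ α₂ l₁ l₂ s‖ := (mul_pos hκ hW0).trans_le hκW
  have hd : (μ : ℂ) + complexExponent c₁ c₂ α₁ α₂ l₁ l₂ s ≠ 0 := norm_pos_iff.mp hd0
  obtain ⟨e, he, hle⟩ := exists_hasDerivAt_complexExponent hc₁ hc₂ hα₁ hα₂ hl₁ hl₂
    (by linarith : 0 < s.re)
  set D := (μ : ℂ) + complexExponent c₁ c₂ α₁ α₂ l₁ l₂ s with hD
  -- The derivative in logarithmic form: the function times its logarithmic derivative.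
  refine ⟨-(s⁻¹ * (μ / D) ^ m * (s⁻¹ + m * (e / D))), ?_, ?_⟩
  · have h1 := (hasDerivAt_inv hs0).mul (((he.const_add (μ : ℂ)).fun_inv hd).const_mul
      (μ : ℂ) |>.fun_pow m)
    obtain ⟨n, rfl⟩ : ∃ n, m = n + 1 := ⟨m - 1, by omega⟩
    have h2 : HasDerivAt (tailTransform c₁ c₂ α₁ α₂ l₁ l₂ μ (n + 1)) _ s := h1
    convert! h2 using 1
    rw [← hD]
    have h3 : (μ : ℂ) * (-e / D ^ 2) = -(μ * D⁻¹ * (e / D)) := by field_simp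
    rw [h3, div_eq_mul_inv (μ : ℂ) D, Nat.add_sub_cancel]
    ring
  · have b1 : ‖e / D‖ ≤ 1 / κ / ‖s‖ := by
      rw [norm_div, div_le_div_iff₀ hd0 hn0, ← mul_le_mul_iff_of_pos_left hκ]
      calc κ * (‖e‖ * ‖s‖) ≤ κ * (exponentWeight c₁ c₂ α₁ α₂ l₁ l₂ s) := by
            gcongr
            exact (le_div_iff₀ hn0).mp hle
        _ ≤ ‖D‖ := hκW
        _ = _ := by field_simp
    have b2 : ‖(μ : ℂ) / D‖ ≤ μ / κ * ‖s‖ ^ (-(min α₁ α₂)) := by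
      rw [norm_div, Complex.norm_real, Real.norm_of_nonneg hμ.le, Real.rpow_neg hn0.le,
        ← div_eq_mul_inv, div_div]
      gcongr
      exact (mul_le_mul_of_nonneg_left hW hκ.le).trans hκW
    -- Of the m available factors |s|^(-min α) ≤ 1 a single one is kept; this is where m ≥ 1 enters.
    have b3 : ‖(μ : ℂ) / D‖ ^ m ≤ (μ / κ) ^ m * ‖s‖ ^ (-(min α₁ α₂)) := by
      have hle1 : ‖s‖ ^ (-(min α₁ α₂)) ≤ 1 :=
        Real.rpow_le_one_of_one_le_of_nonpos hn1 (by linarith)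
      refine (pow_le_pow_left₀ (norm_nonneg _) b2 m).trans ?_
      rw [mul_pow]
      gcongr
      exact pow_le_of_le_one (by positivity) hle1 (by omega)
    rw [norm_neg, norm_mul, norm_mul, norm_pow, norm_inv]
    have b4 : ‖s⁻¹ + m * (e / D)‖ ≤ ‖s‖⁻¹ * (1 + m / κ) := by
      refine (norm_add_le _ _).trans ?_
      rw [norm_inv, norm_mul, Complex.norm_natCast]
      calc ‖s‖⁻¹ + m * ‖e / D‖ ≤ ‖s‖⁻¹ + m * (1 / κ / ‖s‖) := by gcongr
        _ = _ := by field_simp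
    calc ‖s‖⁻¹ * ‖(μ : ℂ) / D‖ ^ m * ‖s⁻¹ + m * (e / D)‖
        ≤ ‖s‖⁻¹ * ((μ / κ) ^ m * ‖s‖ ^ (-(min α₁ α₂))) * (‖s‖⁻¹ * (1 + m / κ)) := by gcongr
      _ = (μ / κ) ^ m * (1 + m / κ) * ‖s‖ ^ (-(2 + min α₁ α₂)) := by
        rw [neg_add, Real.rpow_add hn0, Real.rpow_neg hn0.le 2, Real.rpow_two]
        field_simp

end

/-! ### Regularity from the decay of the Laplace transform -/

/-- A monotone function has a dense set of continuity points. A strict inequality at t would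
persist, by continuity of `h`, at such a point just left of t (if f t < h t) or just right of it (if
h t < f t), against monotonicity. -/
lemma eq_of_monotone_of_eq_on_continuousAt {f h : ℝ → ℝ} (hf : Monotone f)
    (hh : ContinuousOn h (Set.Ioi 0))
    (he : ∀ t, 0 < t → ContinuousAt f t → h t = f t) {t : ℝ} (ht : 0 < t) : h t = f t := by
  have hd : Dense {x | ContinuousAt f x} := by
    simpa [Set.compl_def] using hf.countable_not_continuousAt.dense_compl ℝ
  have hc : ContinuousAt h t := hh.continuousAt (Ioi_mem_nhds ht)
  refine le_antisymm ?_ ?_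
  · by_contra! hlt
    obtain ⟨l, hl, hlu⟩ := exists_Ioc_subset_of_mem_nhds
      ((hc.eventually (lt_mem_nhds hlt)).and (lt_mem_nhds ht)) ⟨t - 1, by linarith⟩
    obtain ⟨u, hu, hu2⟩ := hd.exists_between hl
    have h1 := hlu ⟨hu2.1, hu2.2.le⟩
    have h2 := hf hu2.2.le
    have h3 := he u h1.2 hu
    have h4 : f t < h u := h1.1
    linarith
  · by_contra! hlt
    obtain ⟨l, hl, hlu⟩ := exists_Ico_subset_of_mem_nhds
      (hc.eventually (gt_mem_nhds hlt)) ⟨t + 1, by linarith⟩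
    obtain ⟨u, hu, hu2⟩ := hd.exists_between hl
    have h1 := hlu ⟨hu2.1.le, hu2.2⟩
    have h2 := hf hu2.1.le
    have h3 := he u (ht.trans hu2.1) hu
    have h4 : h u < f t := h1
    linarith

lemma integrableOn_exp_mul_of_bounded {g : ℝ → ℝ} {b C : ℝ}
    (hm : AEStronglyMeasurable g (volume.restrict (Set.Ioi 0)))
    (hC : ∀ t, 0 < t → |g t| ≤ C) (hb : 0 < b) :
    IntegrableOn (fun t => Real.exp (-(b * t)) * g t) (Set.Ioi 0) := by
  have h1 : IntegrableOn (fun t : ℝ => Real.exp (-(b * t))) (Set.Ioi 0) := by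
    simpa using exp_neg_integrableOn_Ioi 0 hb
  refine Integrable.mul_bdd (c := C) h1 hm ?_
  filter_upwards [ae_restrict_mem measurableSet_Ioi] with t ht using hC t ht

/-- On the line the norm is at least 1 and at least |ξ|, hence at least (1 + |ξ|) / 2, whence the
factor 2^(2 + β). Multiplication by |ξ| leaves decay of order 1 + β > 1. -/
lemma integrable_of_norm_le_rpow {f : ℝ → ℂ} {a C β : ℝ} (ha : 1 ≤ a) (hC : 0 ≤ C) (hβ : 0 < β)
    (hf : AEStronglyMeasurable f)
    (h : ∀ ξ : ℝ, ‖f ξ‖ ≤ C * ‖(a : ℂ) + 2 * Real.pi * ξ * Complex.I‖ ^ (-(2 + β))) :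
    Integrable f ∧ Integrable fun ξ : ℝ => |ξ| * ‖f ξ‖ := by
  have hb : ∀ ξ : ℝ, ‖f ξ‖ ≤ C * 2 ^ (2 + β) * (1 + ‖ξ‖) ^ (-(2 + β)) := fun ξ => by
    refine (h ξ).trans ?_
    rw [mul_assoc C]
    refine mul_le_mul_of_nonneg_left ?_ hC
    have h1 : 1 ≤ ‖(a : ℂ) + 2 * Real.pi * ξ * Complex.I‖ := by
      refine ha.trans (le_trans (le_of_eq ?_) (Complex.re_le_norm _))
      simp
    have h2 : ‖ξ‖ ≤ ‖(a : ℂ) + 2 * Real.pi * ξ * Complex.I‖ := by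
      refine le_trans ?_ (Complex.abs_im_le_norm _)
      simp only [Complex.add_im, Complex.ofReal_im, Complex.mul_im, Complex.I_im, Complex.I_re,
        Real.norm_eq_abs]
      simp [abs_mul, abs_of_pos Real.pi_pos]
      have := Real.pi_gt_three
      nlinarith [abs_nonneg ξ]
    have h3 : (1 + ‖ξ‖) / 2 ≤ ‖(a : ℂ) + 2 * Real.pi * ξ * Complex.I‖ := by linarith
    have h4 : 0 < (1 + ‖ξ‖) / 2 := by positivity
    refine (Real.rpow_le_rpow_of_nonpos h4 h3 (by linarith : -(2 + β) ≤ 0)).trans (le_of_eq ?_)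
    rw [Real.div_rpow (by positivity) (by norm_num), Real.rpow_neg (by norm_num : (0:ℝ) ≤ 2),
      div_inv_eq_mul, mul_comm]
  have hi : ∀ r : ℝ, 1 < r → Integrable fun ξ : ℝ => (1 + ‖ξ‖) ^ (-r) := fun r hr =>
    integrable_one_add_norm (by simpa using hr)
  refine ⟨((hi (2 + β) (by linarith)).const_mul _).mono' hf (ae_of_all _ hb),
    ((hi (1 + β) (by linarith)).const_mul (C * 2 ^ (2 + β))).mono'
      (continuous_abs.aestronglyMeasurable.mul hf.norm) (ae_of_all _ fun ξ => ?_)⟩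
  rw [norm_mul, norm_norm, Real.norm_eq_abs, abs_abs]
  calc |ξ| * ‖f ξ‖ ≤ (1 + ‖ξ‖) * (C * 2 ^ (2 + β) * (1 + ‖ξ‖) ^ (-(2 + β))) := by
        gcongr
        · simp
        · exact hb ξ
    _ = _ := by
        rw [show -(1 + β) = 1 + -(2 + β) by ring,
          Real.rpow_add (by positivity : 0 < 1 + ‖ξ‖), Real.rpow_one]
        ring

/-- A bounded monotone function with Laplace transform `s⁻¹ (μ / (μ + φ(s)))^m`, `m ≥ 1`, is
continuously differentiable on `(0, ∞)`, in the strong sense that `t ↦ t Q(t)` extends to a `C¹`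
function on the line. -/
lemma exists_contDiff_eq_mul_tail {c₁ c₂ α₁ α₂ l₁ l₂ μ : ℝ} (hc₁ : 0 ≤ c₁) (hc₂ : 0 ≤ c₂)
    (hc : c₁ + c₂ = 1)
    (hα₁ : α₁ ∈ Set.Ioo (0 : ℝ) 1) (hα₂ : α₂ ∈ Set.Ioo (0 : ℝ) 1) (hl₁ : 0 ≤ l₁) (hl₂ : 0 ≤ l₂)
    (hμ : 0 < μ) {m : ℕ} (hm : 1 ≤ m) {Q : ℝ → ℝ} (hQ : Monotone Q)
    (hQ1 : ∀ t, |Q t| ≤ 1)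
    (hL : ∀ s : ℝ, 0 < s → ∫ t in Set.Ioi (0 : ℝ), Real.exp (-(s * t)) * Q t
      = s⁻¹ * (μ / (μ + laplaceExponent c₁ c₂ α₁ α₂ l₁ l₂ s)) ^ m) :
    ∃ H : ℝ → ℝ, ContDiff ℝ 1 H ∧ ∀ t, 0 < t → H t = t * Q t := by
  obtain ⟨a, ha, C, hd⟩ := exists_hasDerivAt_tailTransform hc₁ hc₂ hc hα₁ hα₂ hl₁ hl₂ hμ hm
  have hQm : AEStronglyMeasurable Q (volume.restrict (Set.Ioi 0)) :=
    hQ.measurable.aestronglyMeasurable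
  have hI : ∀ b : ℝ, 0 < b → IntegrableOn (fun t => Real.exp (-(b * t)) * Q t) (Set.Ioi 0) :=
    fun b hb => integrableOn_exp_mul_of_bounded hQm (fun t _ => hQ1 t) hb
  have hEq : Set.EqOn (laplaceTransform Q) (tailTransform c₁ c₂ α₁ α₂ l₁ l₂ μ m)
      {s | a < s.re} := by
    refine eqOn_laplaceTransform (hI a (by linarith)) (fun s hs => ?_) fun s hs => ?_
    · obtain ⟨d, h1, -⟩ := hd s (le_of_lt hs)
      exact h1.differentiableAt.differentiableWithinAt
    · have hs0 : 0 < s := by linarith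
      rw [laplaceTransform_ofReal, hL s hs0, tailTransform,
        complexExponent_ofReal hl₁ hl₂ hs0.le]
      push_cast
      rfl
  have hop : IsOpen {s : ℂ | a < s.re} := isOpen_lt continuous_const Complex.continuous_re
  -- The transform of t Q(t) is minus the derivative of that of Q, which equals `tailTransform` near
  -- s, so the decay bound transfers.
  have hbound : ∀ s : ℂ, a < s.re →
      ‖laplaceTransform (fun t => t * Q t) s‖ ≤ C * ‖s‖ ^ (-(2 + min α₁ α₂)) := fun s hs => by
    obtain ⟨d, h1, h2⟩ := hd s (le_of_lt hs)
    have h3 := (hasDerivAt_laplaceTransform (hI a (by linarith)) hs).congr_of_eventuallyEq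
      (hEq.symm.eventuallyEq_of_mem (hop.mem_nhds hs))
    rw [← norm_neg, h3.unique h1]
    exact h2
  have hC : 0 ≤ C := by
    have h1 := (norm_nonneg _).trans (hbound ((a + 1 : ℝ) : ℂ) (by
      rw [Complex.ofReal_re]; linarith))
    refine nonneg_of_mul_nonneg_left h1 (Real.rpow_pos_of_pos ?_ _)
    rw [Complex.norm_real, Real.norm_eq_abs]
    exact abs_pos.mpr (by linarith)
  have hg : IntegrableOn (fun t => Real.exp (-(a * t)) * (t * Q t)) (Set.Ioi 0) :=
    integrableOn_exp_mul_id_mul (hI (a / 2) (by linarith)) (by linarith)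
  have hcont : Continuous fun ξ : ℝ => laplaceTransform (fun t => t * Q t)
      ((a + 1 : ℝ) + 2 * Real.pi * ξ * Complex.I) := by
    refine continuous_iff_continuousAt.mpr fun ξ => ?_
    have h1 := (hasDerivAt_laplaceTransform
      (s := (a + 1 : ℝ) + 2 * Real.pi * ξ * Complex.I) hg (by simp)).continuousAt
    exact ContinuousAt.comp (f := fun ξ : ℝ => ((a + 1 : ℝ) : ℂ) + 2 * Real.pi * ξ * Complex.I)
      h1 (by fun_prop)
  have hint := integrable_of_norm_le_rpow (a := a + 1) (by linarith) hC
    (lt_min hα₁.1 hα₂.1) hcont.aestronglyMeasurable fun ξ => hbound _ (by simp)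
  obtain ⟨H, hH, hHe⟩ := exists_contDiff_eq_of_laplaceTransform
    (integrableOn_exp_mul_of_le hg (by linarith : a ≤ a + 1)) hint.1 hint.2
  refine ⟨H, hH, fun t ht => ?_⟩
  -- Inversion yields H(t) = t Q(t) only where Q is continuous; monotonicity of Q removes the
  -- restriction.
  have := eq_of_monotone_of_eq_on_continuousAt (h := fun t => H t / t) hQ
    (hH.continuous.continuousOn.div continuousOn_id fun x hx => (ne_of_gt hx)) (fun u hu hcu => by
      rw [hHe u hu (continuousAt_id.mul hcu)]
      field_simp) ht
  rw [← this]
  field_simp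
/-! ### Fractional integrals -/

lemma intervalIntegrable_sub_rpow {ν : ℝ} (hν : ν < 1) (τ : ℝ) :
    IntervalIntegrable (fun u => (τ - u) ^ (-ν)) volume 0 τ := by
  have h := (intervalIntegral.intervalIntegrable_rpow' (a := τ) (b := 0)
    (by linarith : -1 < -ν)).comp_sub_left τ
  simpa using h

lemma intervalIntegrable_sub_rpow_mul {ν τ B : ℝ} (hν : ν < 1) (hτ : 0 ≤ τ) {g : ℝ → ℝ}
    (hm : AEStronglyMeasurable g (volume.restrict (Set.Ioi 0)))
    (hB : ∀ u ∈ Set.Ioc 0 τ, |g u| ≤ B) :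
    IntervalIntegrable (fun u => (τ - u) ^ (-ν) * g u) volume 0 τ := by
  have h := intervalIntegrable_sub_rpow hν τ
  rw [intervalIntegrable_iff_integrableOn_Ioc_of_le hτ] at h ⊢
  refine Integrable.mul_bdd (c := B) h (hm.mono_measure ?_) ?_
  · exact Measure.restrict_mono Set.Ioc_subset_Ioi_self le_rfl
  · filter_upwards [ae_restrict_mem measurableSet_Ioc] with u hu using hB u hu

/-- The substitution u = t r fixes the domain and takes t out of the singular kernel, so that t can
be differentiated under the integral. -/
lemma integral_sub_rpow_mul_eq {ν t : ℝ} (ht : 0 < t) (g : ℝ → ℝ) :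
    ∫ u in (0 : ℝ)..t, (t - u) ^ (-ν) * g u
      = t ^ (1 - ν) * ∫ r in (0 : ℝ)..1, (1 - r) ^ (-ν) * g (t * r) := by
  have h := intervalIntegral.mul_integral_comp_mul_left (a := 0) (b := 1)
    (f := fun u => (t - u) ^ (-ν) * g u) t
  rw [mul_zero, mul_one] at h
  rw [← h, sub_eq_add_neg, Real.rpow_add ht, Real.rpow_one, mul_assoc,
    ← intervalIntegral.integral_const_mul (t ^ (-ν))]
  refine congrArg (t * ·) (intervalIntegral.integral_congr fun r hr => ?_)
  rw [Set.uIcc_of_le zero_le_one] at hr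
  rw [← mul_assoc, ← Real.mul_rpow ht.le (by linarith [hr.2])]
  congr 2
  ring

/-- The integral `∫₀ᵗ (t - u)^(-ν) g(u) du` is differentiable at `t > 0` if `g` is locally bounded
and `u ↦ u g(u)` extends to a `C¹` function. -/
lemma differentiableAt_integral_sub_rpow_mul {ν t : ℝ} (hν : ν < 1) (ht : 0 < t) {g G : ℝ → ℝ}
    (hG : ContDiff ℝ 1 G) (hGg : ∀ u, 0 < u → G u = u * g u) {B : ℝ}
    (hB : ∀ u ∈ Set.Ioc 0 (2 * t), |g u| ≤ B) :
    DifferentiableAt ℝ (fun t => ∫ u in (0 : ℝ)..t, (t - u) ^ (-ν) * g u) t := by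
  obtain ⟨M, hM⟩ := (isCompact_Icc (a := (0 : ℝ)) (b := 2 * t)).exists_bound_of_continuousOn
    (hG.continuous_deriv le_rfl).continuousOn
  have hgeq : ∀ x r : ℝ, 0 < x → 0 < r → g (x * r) = G (x * r) / (x * r) := fun x r hx hr => by
    rw [hGg _ (mul_pos hx hr)]; field_simp
  have hmeas : ∀ x : ℝ, 0 < x → AEStronglyMeasurable (fun r => (1 - r) ^ (-ν) * g (x * r))
      (volume.restrict (Set.uIoc 0 1)) := fun x hx => by
    have hGm := hG.continuous.measurable
    have h1 : Measurable fun r : ℝ => (1 - r) ^ (-ν) * (G (x * r) / (x * r)) := by fun_prop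
    refine h1.aestronglyMeasurable.congr ?_
    rw [Set.uIoc_of_le zero_le_one]
    filter_upwards [ae_restrict_mem measurableSet_Ioc] with r hr
    rw [hgeq x r hx hr.1]
  have hmem : ∀ x ∈ Metric.ball t (t / 2), t / 2 < x ∧ x < 3 * t / 2 := fun x hx => by
    rw [Metric.mem_ball, Real.dist_eq, abs_lt] at hx
    constructor <;> linarith [hx.1, hx.2]
  have hint := intervalIntegrable_sub_rpow hν 1
  -- Since G(u) = u g(u), the x-derivative r g'(x r) of g(x r) equals (G'(x r) - g(x r)) / x. It
  -- stays bounded as r → 0 even if g' does not, so a multiple of the kernel dominates. On the ball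
  -- t/2 < x < 3t/2, whence the denominator t/2 and the range (0, 2t].
  have key := intervalIntegral.hasDerivAt_integral_of_dominated_loc_of_deriv_le
    (μ := volume) (a := 0) (b := 1) (x₀ := t)
    (F := fun x r => (1 - r) ^ (-ν) * g (x * r))
    (F' := fun x r => (1 - r) ^ (-ν) * ((deriv G (x * r) - g (x * r)) / x))
    (bound := fun r => (1 - r) ^ (-ν) * ((M + B) / (t / 2)))
    (Metric.ball_mem_nhds t (half_pos ht)) ?_ ?_ ?_ ?_ ?_ ?_
  · have h2 : DifferentiableAt ℝ
        (fun x : ℝ => x ^ (1 - ν) * ∫ r in (0 : ℝ)..1, (1 - r) ^ (-ν) * g (x * r)) t :=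
      (Real.differentiableAt_rpow_const_of_ne _ ht.ne').mul key.2.differentiableAt
    refine h2.congr_of_eventuallyEq ?_
    filter_upwards [lt_mem_nhds ht] with x hx using integral_sub_rpow_mul_eq hx g
  · filter_upwards [lt_mem_nhds ht] with x hx using hmeas x hx
  · rw [intervalIntegrable_iff] at hint ⊢
    refine Integrable.mono' (hint.mul_const B) (hmeas t ht) ?_
    rw [Set.uIoc_of_le zero_le_one]
    filter_upwards [ae_restrict_mem measurableSet_Ioc] with r hr
    have h0 : 0 ≤ (1 - r) ^ (-ν) := Real.rpow_nonneg (by linarith [hr.2]) _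
    rw [norm_mul, Real.norm_of_nonneg h0]
    exact mul_le_mul_of_nonneg_left
      (hB _ ⟨mul_pos ht hr.1, by nlinarith [hr.2, hr.1]⟩) h0
  · have hGm := (hG.continuous_deriv le_rfl).measurable
    have h1 : AEStronglyMeasurable (fun r : ℝ => (1 - r) ^ (-ν) * (deriv G (t * r) / t))
      (volume.restrict (Set.uIoc 0 1)) := by
      refine Measurable.aestronglyMeasurable ?_
      fun_prop
    refine (h1.sub ((hmeas t ht).mul_const (1 / t))).congr (ae_of_all _ fun r => ?_)
    simp only [Pi.sub_apply]
    ring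
  · refine ae_of_all _ fun r hr x hx => ?_
    rw [Set.uIoc_of_le zero_le_one] at hr
    obtain ⟨hx1, hx2⟩ := hmem x hx
    have hx0 : 0 < x := by linarith
    have h0 : 0 ≤ (1 - r) ^ (-ν) := Real.rpow_nonneg (by linarith [hr.2]) _
    have hxr : x * r ≤ 2 * t := by nlinarith [hr.2, hr.1]
    have hxr0 : 0 < x * r := mul_pos hx0 hr.1
    rw [norm_mul, Real.norm_of_nonneg h0, norm_div, Real.norm_of_nonneg hx0.le]
    refine mul_le_mul_of_nonneg_left ?_ h0
    have h3 : ‖deriv G (x * r) - g (x * r)‖ ≤ M + B :=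
      (norm_sub_le _ _).trans (add_le_add (hM _ ⟨hxr0.le, hxr⟩) (hB _ ⟨hxr0, hxr⟩))
    exact div_le_div₀ ((norm_nonneg _).trans h3) h3 (half_pos ht) hx1.le
  · exact hint.mul_const _
  · refine ae_of_all _ fun r hr x hx => ?_
    rw [Set.uIoc_of_le zero_le_one] at hr
    have hx0 : 0 < x := by linarith [(hmem x hx).1]
    have hr0 := hr.1
    refine HasDerivAt.const_mul _ ?_
    have h1 : HasDerivAt (fun y => y * r) r x := by simpa using (hasDerivAt_id x).mul_const r
    have h2 : HasDerivAt (fun y => G (y * r)) (deriv G (x * r) * r) x :=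
      ((hG.differentiable one_ne_zero _).hasDerivAt).comp x h1
    have h3 := h2.fun_div h1 (mul_pos hx0 hr0).ne'
    have h4 : HasDerivAt (fun y => g (y * r)) _ x := h3.congr_of_eventuallyEq (by
      filter_upwards [lt_mem_nhds hx0] with y hy using hgeq y r hy hr0)
    convert! h4 using 1
    rw [hgeq x r hx0 hr0]
    field_simp

lemma differentiableAt_fracIntegral {ν t : ℝ} (hν : ν < 1) (ht : 0 < t) {g G : ℝ → ℝ}
    (hG : ContDiff ℝ 1 G) (hGg : ∀ u, 0 < u → G u = u * g u) {B : ℝ}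
    (hB : ∀ u ∈ Set.Ioc 0 (2 * t), |g u| ≤ B) :
    DifferentiableAt ℝ (fracIntegral ν g) t := by
  refine DifferentiableAt.const_mul ?_ _
  refine differentiableAt_integral_sub_rpow_mul (g := fun u => g u - g 0)
    (G := fun u => G u - u * g 0) (B := B + |g 0|) hν ht ?_ (fun u hu => ?_) fun u hu => ?_
  · exact hG.sub (by fun_prop)
  · rw [hGg u hu]; ring
  · exact (abs_sub _ _).trans (add_le_add (hB u hu) le_rfl)

/-! ### Primitives and tempered fractional integrals under the Laplace transform -/

lemma intervalIntegrable_of_integrableOn_exp_mul {h : ℝ → ℝ} {b t : ℝ}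
    (hh : IntegrableOn (fun t => Real.exp (-(b * t)) * h t) (Set.Ioi 0)) (ht : 0 ≤ t) :
    IntervalIntegrable h volume 0 t := by
  have h1 : IntervalIntegrable (fun t => Real.exp (-(b * t)) * h t) volume 0 t :=
    (intervalIntegrable_iff_integrableOn_Ioc_of_le ht).mpr
      (hh.mono_set Set.Ioc_subset_Ioi_self)
  have h2 := h1.continuousOn_mul (g := fun t => Real.exp (b * t)) (by fun_prop)
  refine h2.congr fun u _ => ?_
  rw [← mul_assoc, ← Real.exp_add]
  simp

lemma hasDerivAt_primitive {h : ℝ → ℝ} {b t : ℝ}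
    (hh : IntegrableOn (fun t => Real.exp (-(b * t)) * h t) (Set.Ioi 0)) (ht : 0 < t)
    (hc : ContinuousAt h t) : HasDerivAt (fun t => ∫ u in (0 : ℝ)..t, h u) (h t) t :=
  intervalIntegral.integral_hasDerivAt_right
    (intervalIntegrable_of_integrableOn_exp_mul hh ht.le)
    ⟨Set.Ioi 0, Ioi_mem_nhds ht, aestronglyMeasurable_of_integrableOn_exp_mul hh⟩ hc

/-- Laplace transform of a convolution on the half-line, with the integrability it needs. -/
lemma laplace_posConvolution {f k : ℝ → ℝ} {s : ℝ}
    (hf : IntegrableOn (fun t => Real.exp (-(s * t)) * f t) (Set.Ioi 0))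
    (hk : IntegrableOn (fun t => Real.exp (-(s * t)) * k t) (Set.Ioi 0)) :
    IntegrableOn (fun t => Real.exp (-(s * t)) * ∫ u in (0 : ℝ)..t, f u * k (t - u)) (Set.Ioi 0) ∧
    ∫ t in Set.Ioi (0 : ℝ), Real.exp (-(s * t)) * ∫ u in (0 : ℝ)..t, f u * k (t - u)
      = (∫ t in Set.Ioi (0 : ℝ), Real.exp (-(s * t)) * f t)
        * ∫ t in Set.Ioi (0 : ℝ), Real.exp (-(s * t)) * k t := by
  have heq : ∀ t : ℝ, Real.exp (-(s * t)) * ∫ u in (0 : ℝ)..t, f u * k (t - u)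
      = ∫ u in (0 : ℝ)..t, ContinuousLinearMap.mul ℝ ℝ (Real.exp (-(s * u)) * f u)
        (Real.exp (-(s * (t - u))) * k (t - u)) := fun t => by
    rw [← intervalIntegral.integral_const_mul]
    refine intervalIntegral.integral_congr fun u _ => ?_
    have : Real.exp (-(s * t)) = Real.exp (-(s * u)) * Real.exp (-(s * (t - u))) := by
      rw [← Real.exp_add]; ring_nf
    simp only [ContinuousLinearMap.mul_apply', this]
    ring
  constructor
  · have h1 := (integrable_posConvolution hf hk (ContinuousLinearMap.mul ℝ ℝ)).integrableOn
      (s := Set.Ioi 0)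
    refine h1.congr_fun (fun t ht => ?_) measurableSet_Ioi
    rw [posConvolution, Set.indicator_of_mem ht]
    exact (heq t).symm
  · simp_rw [heq]
    exact integral_posConvolution hf hk (ContinuousLinearMap.mul ℝ ℝ)

/-- Integration from 0 is convolution with the constant 1, whose transform is s⁻¹. -/
lemma laplace_primitive {h : ℝ → ℝ} {s : ℝ} (hs : 0 < s)
    (hh : IntegrableOn (fun t => Real.exp (-(s * t)) * h t) (Set.Ioi 0)) :
    IntegrableOn (fun t => Real.exp (-(s * t)) * ∫ u in (0 : ℝ)..t, h u) (Set.Ioi 0) ∧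
    ∫ t in Set.Ioi (0 : ℝ), Real.exp (-(s * t)) * ∫ u in (0 : ℝ)..t, h u
      = s⁻¹ * ∫ t in Set.Ioi (0 : ℝ), Real.exp (-(s * t)) * h t := by
  have h1 : IntegrableOn (fun t : ℝ => Real.exp (-(s * t)) * (fun _ => (1 : ℝ)) t)
      (Set.Ioi 0) := by simpa using exp_neg_integrableOn_Ioi 0 hs
  have h2 := laplace_posConvolution hh h1
  have h3 : ∫ t in Set.Ioi (0 : ℝ), Real.exp (-(s * t)) * (fun _ => (1 : ℝ)) t = s⁻¹ := by
    have := integral_exp_mul_Ioi (neg_lt_zero.mpr hs) 0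
    simpa [neg_div_neg_eq] using this
  rw [h3] at h2
  simpa only [mul_one, mul_comm s⁻¹] using h2

/-- The tempered fractional integral `e^(-ct) I^(1-ν)(e^(c·) f)(t)`. -/
noncomputable def temperedIntegral (c ν : ℝ) (f : ℝ → ℝ) (t : ℝ) : ℝ :=
  Real.exp (-(c * t)) * fracIntegral ν (fun u => Real.exp (c * u) * f u) t

/-- With f(0) = 0 the subtracted initial value disappears and a convolution with the tempered kernel
remains. -/
lemma temperedIntegral_eq {c ν : ℝ} {f : ℝ → ℝ} (hf0 : f 0 = 0) (t : ℝ) :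
    temperedIntegral c ν f t = ∫ u in (0 : ℝ)..t,
      f u * ((Real.Gamma (1 - ν))⁻¹ * (Real.exp (-(c * (t - u))) * (t - u) ^ (-ν))) := by
  rw [temperedIntegral, fracIntegral, ← intervalIntegral.integral_const_mul,
    ← intervalIntegral.integral_const_mul]
  refine intervalIntegral.integral_congr fun u _ => ?_
  have : Real.exp (-(c * (t - u))) = Real.exp (-(c * t)) * Real.exp (c * u) := by
    rw [← Real.exp_add]; ring_nf
  simp only [this, hf0]
  ring

lemma laplace_tempered_kernel {c ν s : ℝ} (hc : 0 ≤ c) (hν : ν < 1) (hs : 0 < s) :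
    IntegrableOn (fun t => Real.exp (-(s * t)) *
      ((Real.Gamma (1 - ν))⁻¹ * (Real.exp (-(c * t)) * t ^ (-ν)))) (Set.Ioi 0) ∧
    ∫ t in Set.Ioi (0 : ℝ), Real.exp (-(s * t)) *
      ((Real.Gamma (1 - ν))⁻¹ * (Real.exp (-(c * t)) * t ^ (-ν))) = (s + c) ^ (ν - 1) := by
  have h1 := Real.integral_rpow_mul_exp_neg_mul_Ioi (a := 1 - ν) (r := s + c)
    (by linarith) (by linarith)
  have hΓ : 0 < Real.Gamma (1 - ν) := Real.Gamma_pos_of_pos (by linarith)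
  have hpos : 0 < (1 / (s + c)) ^ (1 - ν) * Real.Gamma (1 - ν) := by
    have : 0 < s + c := by linarith
    positivity
  have h2 : IntegrableOn (fun t : ℝ => t ^ (1 - ν - 1) * Real.exp (-((s + c) * t)))
      (Set.Ioi 0) := by
    -- A non-integrable function has integral 0 by convention, whereas this Gamma integral is
    -- positive. Integrability follows from the value.
    by_contra hcon
    rw [integral_undef hcon] at h1
    exact hpos.ne h1
  have heq : (fun t : ℝ => Real.exp (-(s * t)) *
      ((Real.Gamma (1 - ν))⁻¹ * (Real.exp (-(c * t)) * t ^ (-ν))))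
      = fun t => (Real.Gamma (1 - ν))⁻¹ * (t ^ (1 - ν - 1) * Real.exp (-((s + c) * t))) := by
    ext t
    have : Real.exp (-((s + c) * t)) = Real.exp (-(s * t)) * Real.exp (-(c * t)) := by
      rw [← Real.exp_add]; ring_nf
    rw [this, show 1 - ν - 1 = -ν by ring]
    ring
  rw [heq]
  refine ⟨h2.const_mul _, ?_⟩
  rw [integral_const_mul, h1, one_div, Real.inv_rpow (by linarith), ← Real.rpow_neg (by linarith)]
  field_simp
  ring_nf

lemma laplace_temperedIntegral {c ν s : ℝ} (hc : 0 ≤ c) (hν : ν < 1) (hs : 0 < s) {f : ℝ → ℝ}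
    (hf0 : f 0 = 0) (hf : IntegrableOn (fun t => Real.exp (-(s * t)) * f t) (Set.Ioi 0)) :
    IntegrableOn (fun t => Real.exp (-(s * t)) * temperedIntegral c ν f t) (Set.Ioi 0) ∧
    ∫ t in Set.Ioi (0 : ℝ), Real.exp (-(s * t)) * temperedIntegral c ν f t
      = (s + c) ^ (ν - 1) * ∫ t in Set.Ioi (0 : ℝ), Real.exp (-(s * t)) * f t := by
  obtain ⟨h1, h2⟩ := laplace_tempered_kernel hc hν hs
  have h3 := laplace_posConvolution hf h1
  simp_rw [temperedIntegral_eq hf0]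
  rw [h2] at h3
  exact ⟨h3.1, h3.2.trans (mul_comm _ _)⟩

/-- Product rule: the shifted derivative is (d/dt + c) applied to the tempered integral. -/
lemma hasDerivAt_temperedIntegral {c ν t : ℝ} {f : ℝ → ℝ}
    (hd : DifferentiableAt ℝ (fracIntegral ν (fun u => Real.exp (c * u) * f u)) t) :
    HasDerivAt (temperedIntegral c ν f)
      (shiftedFracDeriv c ν f t - c * temperedIntegral c ν f t) t := by
  have h1 : HasDerivAt (fun t => Real.exp (-(c * t))) (Real.exp (-(c * t)) * (-c)) t := by
    have := ((hasDerivAt_id t).const_mul c).fun_neg.exp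
    simpa using this
  convert! h1.mul hd.hasDerivAt using 1
  rw [shiftedFracDeriv, fracDeriv, temperedIntegral]
  ring

/-- The shifted fractional derivative exists for functions that are `C¹` on `(0, ∞)` and locally
bounded, with `u f'(u)` bounded near `0`. -/
lemma shiftedFracDifferentiableAt_of_contDiff {c ν t : ℝ} (hc : 0 ≤ c) (hν : ν < 1) (ht : 0 < t)
    {f H : ℝ → ℝ}
    (hH : ContDiff ℝ 1 H) (hHf : ∀ u, 0 < u → H u = u * f u) (hf : ∀ u, |f u| ≤ 1) :
    ShiftedFracDifferentiableAt c ν f t := by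
  have hbd : ∀ τ u, u ∈ Set.Ioc 0 τ → |Real.exp (c * u) * f u| ≤ Real.exp (c * τ) :=
    fun τ u hu => by
      rw [abs_mul, Real.abs_exp]
      calc Real.exp (c * u) * |f u| ≤ Real.exp (c * τ) * 1 := by
            gcongr
            · exact hu.2
            · exact hf u
        _ = _ := mul_one _
  have hm : AEStronglyMeasurable (fun u => Real.exp (c * u) * f u - f 0)
      (volume.restrict (Set.Ioi 0)) := by
    have hHm := hH.continuous.measurable
    have : Measurable fun u => Real.exp (c * u) * (H u / u) - f 0 := by fun_prop
    refine this.aestronglyMeasurable.congr ?_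
    filter_upwards [ae_restrict_mem measurableSet_Ioi] with u hu
    have hu : 0 < u := hu
    rw [hHf u hu]
    field_simp
  refine ⟨fun τ hτ => ?_, ?_⟩
  · refine intervalIntegrable_sub_rpow_mul (B := Real.exp (c * τ) + |f 0|) hν hτ hm fun u hu => ?_
    exact (abs_sub _ _).trans (add_le_add (hbd τ u hu) le_rfl)
  · refine differentiableAt_fracIntegral (G := fun u => Real.exp (c * u) * H u) hν ht ?_
      (fun u hu => ?_) (hbd (2 * t))
    · exact ContDiff.mul (by fun_prop) hH
    · rw [hHf u hu]; ring
/-! ### From the Laplace transforms of the tails to the governing equation -/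

/-- The Laplace integral of `g` at `s` converges absolutely and has the value `L`. -/
def HasLaplaceAt (g : ℝ → ℝ) (s L : ℝ) : Prop :=
  IntegrableOn (fun t => Real.exp (-(s * t)) * g t) (Set.Ioi 0) ∧
    ∫ t in Set.Ioi (0 : ℝ), Real.exp (-(s * t)) * g t = L

namespace HasLaplaceAt

variable {f g : ℝ → ℝ} {s L M : ℝ}

lemma add (hf : HasLaplaceAt f s L) (hg : HasLaplaceAt g s M) :
    HasLaplaceAt (fun t => f t + g t) s (L + M) := by
  simp only [HasLaplaceAt, mul_add]
  exact ⟨hf.1.add hg.1, by rw [integral_add hf.1 hg.1, hf.2, hg.2]⟩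

lemma sub (hf : HasLaplaceAt f s L) (hg : HasLaplaceAt g s M) :
    HasLaplaceAt (fun t => f t - g t) s (L - M) := by
  simp only [HasLaplaceAt, mul_sub]
  exact ⟨hf.1.sub hg.1, by rw [integral_sub hf.1 hg.1, hf.2, hg.2]⟩

lemma const_mul (c : ℝ) (hf : HasLaplaceAt f s L) :
    HasLaplaceAt (fun t => c * f t) s (c * L) := by
  simp only [HasLaplaceAt, mul_left_comm _ c]
  exact ⟨hf.1.const_mul c, by rw [integral_const_mul, hf.2]⟩

lemma primitive (hs : 0 < s) (hf : HasLaplaceAt f s L) :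
    HasLaplaceAt (fun t => ∫ u in (0 : ℝ)..t, f u) s (s⁻¹ * L) := by
  have := laplace_primitive hs hf.1
  rwa [hf.2] at this

lemma temperedIntegral {c ν : ℝ} (hc : 0 ≤ c) (hν : ν < 1) (hs : 0 < s) (hf0 : f 0 = 0)
    (hf : HasLaplaceAt f s L) :
    HasLaplaceAt (temperedIntegral c ν f) s ((s + c) ^ (ν - 1) * L) := by
  have := laplace_temperedIntegral hc hν hs hf0 hf.1
  rwa [hf.2] at this

end HasLaplaceAt

lemma eq_of_hasLaplaceAt {f g : ℝ → ℝ} {b : ℝ} {L : ℝ → ℝ}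
    (hf : ∀ s, b ≤ s → HasLaplaceAt f s (L s)) (hg : ∀ s, b ≤ s → HasLaplaceAt g s (L s))
    {t : ℝ} (ht : 0 < t)
    (hft : ContinuousAt f t) (hgt : ContinuousAt g t) : f t = g t := by
  have h : ∀ s, b ≤ s → HasLaplaceAt (fun t => f t - g t) s 0 := fun s hs => by
    simpa using (hf s hs).sub (hg s hs)
  exact sub_eq_zero.mp (eq_zero_of_laplace_eq_zero (h b le_rfl).1 (fun s hs => (h s hs.le).2) ht
    (hft.sub hgt))

section

variable {c₁ c₂ α₁ α₂ l₁ l₂ μ : ℝ}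

lemma laplaceExponent_nonneg (hc₁ : 0 ≤ c₁) (hc₂ : 0 ≤ c₂)
    (hα₁ : α₁ ∈ Set.Ioo (0 : ℝ) 1) (hα₂ : α₂ ∈ Set.Ioo (0 : ℝ) 1) (hl₁ : 0 ≤ l₁) (hl₂ : 0 ≤ l₂)
    {s : ℝ} (hs : 0 ≤ s) : 0 ≤ laplaceExponent c₁ c₂ α₁ α₂ l₁ l₂ s := by
  have h₁ := Real.rpow_le_rpow hl₁ (by linarith : l₁ ≤ s + l₁) hα₁.1.le
  have h₂ := Real.rpow_le_rpow hl₂ (by linarith : l₂ ≤ s + l₂) hα₂.1.le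
  exact add_nonneg (mul_nonneg hc₁ (sub_nonneg.mpr h₁)) (mul_nonneg hc₂ (sub_nonneg.mpr h₂))

lemma tendsto_laplaceExponent_atTop (hc₁ : 0 ≤ c₁) (hc₂ : 0 ≤ c₂) (hc : c₁ + c₂ = 1)
    (hα₁ : α₁ ∈ Set.Ioo (0 : ℝ) 1) (hα₂ : α₂ ∈ Set.Ioo (0 : ℝ) 1) (hl₁ : 0 ≤ l₁) (hl₂ : 0 ≤ l₂) :
    Tendsto (laplaceExponent c₁ c₂ α₁ α₂ l₁ l₂) atTop atTop := by
  refine tendsto_atTop_mono' _ ?_ (tendsto_atTop_add_const_right _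
    (-(c₁ * l₁ ^ α₁ + c₂ * l₂ ^ α₂)) (tendsto_rpow_atTop (lt_min hα₁.1 hα₂.1)))
  filter_upwards [eventually_ge_atTop 1] with s hs
  have key : ∀ {α l : ℝ}, 0 ≤ l → 0 < α → min α₁ α₂ ≤ α → s ^ (min α₁ α₂) ≤ (s + l) ^ α :=
    fun {α l} hl hα h => (Real.rpow_le_rpow_of_exponent_le hs h).trans
      (Real.rpow_le_rpow (by linarith) (by linarith) hα.le)
  have h₁ := mul_le_mul_of_nonneg_left (key hl₁ hα₁.1 (min_le_left _ _)) hc₁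
  have h₂ := mul_le_mul_of_nonneg_left (key hl₂ hα₂.1 (min_le_right _ _)) hc₂
  have h₃ : s ^ (min α₁ α₂) = c₁ * s ^ (min α₁ α₂) + c₂ * s ^ (min α₁ α₂) := by
    rw [← add_mul, hc, one_mul]
  rw [laplaceExponent]
  linarith

lemma laplaceExponent_pos (hc₁ : 0 ≤ c₁) (hc₂ : 0 ≤ c₂) (hc : c₁ + c₂ = 1)
    (hα₁ : α₁ ∈ Set.Ioo (0 : ℝ) 1) (hα₂ : α₂ ∈ Set.Ioo (0 : ℝ) 1) (hl₁ : 0 ≤ l₁) (hl₂ : 0 ≤ l₂) :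
    ∃ s > 0, 0 < laplaceExponent c₁ c₂ α₁ α₂ l₁ l₂ s := by
  obtain ⟨s, h1, h2⟩ := (((tendsto_laplaceExponent_atTop hc₁ hc₂ hc hα₁ hα₂ hl₁
    hl₂).eventually_gt_atTop 0).and (eventually_gt_atTop 0)).exists
  exact ⟨s, h2, h1⟩

/-- A monotone function whose Laplace transform is `s⁻¹ (μ / (μ + φ(s)))^m` with `m ≥ 1` is
nonpositive at `0`. -/
lemma tail_zero_nonpos (hc₁ : 0 ≤ c₁) (hc₂ : 0 ≤ c₂) (hc : c₁ + c₂ = 1)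
    (hα₁ : α₁ ∈ Set.Ioo (0 : ℝ) 1) (hα₂ : α₂ ∈ Set.Ioo (0 : ℝ) 1) (hl₁ : 0 ≤ l₁) (hl₂ : 0 ≤ l₂)
    {m : ℕ} (hm : 1 ≤ m) {Q : ℝ → ℝ} (hQ : Monotone Q)
    (hL : ∀ s : ℝ, 0 < s → HasLaplaceAt Q s
      (s⁻¹ * (μ / (μ + laplaceExponent c₁ c₂ α₁ α₂ l₁ l₂ s)) ^ m)) : Q 0 ≤ 0 := by
  have h1 : Tendsto (fun s => (μ / (μ + laplaceExponent c₁ c₂ α₁ α₂ l₁ l₂ s)) ^ m) atTop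
      (𝓝 0) := by
    have := ((tendsto_atTop_add_const_left _ μ (tendsto_laplaceExponent_atTop hc₁ hc₂ hc hα₁
      hα₂ hl₁ hl₂)).const_div_atTop μ).pow m
    rwa [zero_pow (by omega)] at this
  refine ge_of_tendsto h1 ?_
  filter_upwards [eventually_gt_atTop 0] with s hs
  obtain ⟨hI, hv⟩ := hL s hs
  have he : IntegrableOn (fun t : ℝ => Real.exp (-(s * t))) (Set.Ioi 0) := by
    simpa using exp_neg_integrableOn_Ioi 0 hs
  -- Monotonicity gives Q(0) / s ≤ L[Q](s) = s⁻¹ ρ^m, and ρ → 0 as s → ∞ because φ does not stay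
  -- bounded.
  have h2 : ∫ t in Set.Ioi (0 : ℝ), Real.exp (-(s * t)) * Q 0
      ≤ ∫ t in Set.Ioi (0 : ℝ), Real.exp (-(s * t)) * Q t := by
    refine setIntegral_mono_on (he.mul_const _) hI measurableSet_Ioi fun t ht => ?_
    exact mul_le_mul_of_nonneg_left (hQ (le_of_lt ht)) (Real.exp_pos _).le
  have h3 : ∫ t in Set.Ioi (0 : ℝ), Real.exp (-(s * t)) = s⁻¹ := by
    have := integral_exp_mul_Ioi (neg_lt_zero.mpr hs) 0
    simpa [neg_div_neg_eq] using this
  rw [integral_mul_const, h3, hv] at h2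
  exact le_of_mul_le_mul_left h2 (inv_pos.mpr hs)

/-- The analytic half of the argument: probability enters only through monotone bounded tails with
the given transforms. Comparing primitives avoids any integrability question for the fractional
derivatives. -/
theorem governing_equation_of_tails (hc₁ : 0 ≤ c₁) (hc₂ : 0 ≤ c₂) (hc : c₁ + c₂ = 1)
    (hα₁ : α₁ ∈ Set.Ioo (0 : ℝ) 1) (hα₂ : α₂ ∈ Set.Ioo (0 : ℝ) 1) (hl₁ : 0 ≤ l₁) (hl₂ : 0 ≤ l₂)
    (hμ : 0 < μ) {Q : ℕ → ℝ → ℝ} (hQ : ∀ m, Monotone (Q m)) (hQ0 : ∀ m t, 0 ≤ Q m t)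
    (hQ1 : ∀ m t, Q m t ≤ 1) (hQone : ∀ t, Q 0 t = 1)
    (hL : ∀ m, ∀ s : ℝ, 0 < s → HasLaplaceAt (Q m) s
      (s⁻¹ * (μ / (μ + laplaceExponent c₁ c₂ α₁ α₂ l₁ l₂ s)) ^ m))
    {p : ℕ → ℝ → ℝ} (hp : ∀ m t, p m t = Q m t - Q (m + 1) t)
    {k : ℕ} (hk : 1 ≤ k) {t : ℝ} (ht : 0 < t) :
    ShiftedFracDifferentiableAt l₁ α₁ (p k) t ∧ ShiftedFracDifferentiableAt l₂ α₂ (p k) t ∧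
    c₁ * shiftedFracDeriv l₁ α₁ (p k) t + c₂ * shiftedFracDeriv l₂ α₂ (p k) t
      = -μ * (p k t - p (k - 1) t) + (c₁ * l₁ ^ α₁ + c₂ * l₂ ^ α₂) * p k t := by
  have hreg : ∀ m, ∃ H : ℝ → ℝ, ContDiff ℝ 1 H ∧ ∀ t, 0 < t → H t = t * Q m t := fun m => by
    rcases Nat.eq_zero_or_pos m with rfl | hm
    · exact ⟨id, contDiff_id, fun t _ => by simp [hQone]⟩
    · exact exists_contDiff_eq_mul_tail hc₁ hc₂ hc hα₁ hα₂ hl₁ hl₂ hμ hm (hQ m)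
        (fun t => abs_le.mpr ⟨by linarith [hQ0 m t], hQ1 m t⟩) fun s hs => (hL m s hs).2
  have hpreg : ∀ m, ∃ H : ℝ → ℝ, ContDiff ℝ 1 H ∧ ∀ t, 0 < t → H t = t * p m t := fun m => by
    obtain ⟨H₁, h₁, e₁⟩ := hreg m
    obtain ⟨H₂, h₂, e₂⟩ := hreg (m + 1)
    exact ⟨fun t => H₁ t - H₂ t, h₁.sub h₂, fun t ht => by
      simp only [e₁ t ht, e₂ t ht, hp]; ring⟩
  have hpb : ∀ m t, |p m t| ≤ 1 := fun m t => by
    rw [hp, abs_le]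
    constructor <;> linarith [hQ0 m t, hQ1 m t, hQ0 (m + 1) t, hQ1 (m + 1) t]
  have hpc : ∀ m t, 0 < t → ContinuousAt (p m) t := fun m t ht => by
    obtain ⟨H, hH, e⟩ := hpreg m
    have : ContinuousAt (fun t => H t / t) t :=
      hH.continuous.continuousAt.div continuousAt_id ht.ne'
    refine this.congr ?_
    filter_upwards [lt_mem_nhds ht] with u hu
    rw [e u hu]
    field_simp
  -- The vanishing initial value makes the tempered integrals of p_k genuine convolutions.
  have hp0 : p k 0 = 0 := by
    have h0 : ∀ m, 1 ≤ m → Q m 0 = 0 := fun m hm =>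
      le_antisymm (tail_zero_nonpos hc₁ hc₂ hc hα₁ hα₂ hl₁ hl₂ hm (hQ m) (hL m)) (hQ0 m 0)
    rw [hp, h0 k hk, h0 (k + 1) (by omega), sub_zero]
  have hpL : ∀ m, ∀ s : ℝ, 0 < s → HasLaplaceAt (p m) s
      (s⁻¹ * (μ / (μ + laplaceExponent c₁ c₂ α₁ α₂ l₁ l₂ s)) ^ m
        - s⁻¹ * (μ / (μ + laplaceExponent c₁ c₂ α₁ α₂ l₁ l₂ s)) ^ (m + 1)) := fun m s hs => by
    rw [funext (hp m)]
    exact (hL m s hs).sub (hL (m + 1) s hs)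
  obtain ⟨H, hH, he⟩ := hpreg k
  have hd₁ : ∀ u, 0 < u → ShiftedFracDifferentiableAt l₁ α₁ (p k) u := fun u hu =>
    shiftedFracDifferentiableAt_of_contDiff hl₁ hα₁.2 hu hH he (hpb k)
  have hd₂ : ∀ u, 0 < u → ShiftedFracDifferentiableAt l₂ α₂ (p k) u := fun u hu =>
    shiftedFracDifferentiableAt_of_contDiff hl₂ hα₂.2 hu hH he (hpb k)
  refine ⟨hd₁ t ht, hd₂ t ht, ?_⟩
  set Λ := c₁ * l₁ ^ α₁ + c₂ * l₂ ^ α₂ with hΛ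
  set V₁ := temperedIntegral l₁ α₁ (p k) with hV₁
  set V₂ := temperedIntegral l₂ α₂ (p k) with hV₂
  set r : ℝ → ℝ := fun t => -μ * (p k t - p (k - 1) t) + Λ * p k t with hr
  have hV₁' : ∀ u, 0 < u → HasDerivAt V₁ _ u := fun u hu =>
    hasDerivAt_temperedIntegral (hd₁ u hu).2
  have hV₂' : ∀ u, 0 < u → HasDerivAt V₂ _ u := fun u hu =>
    hasDerivAt_temperedIntegral (hd₂ u hu).2
  have hrc : ∀ u, 0 < u → ContinuousAt r u := fun u hu =>
    (((hpc k u hu).sub (hpc (k - 1) u hu)).const_mul _).add ((hpc k u hu).const_mul _)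
  have hV₁L : ∀ s, 0 < s → HasLaplaceAt V₁ s _ := fun s hs =>
    (hpL k s hs).temperedIntegral hl₁ hα₁.2 hs hp0
  have hV₂L : ∀ s, 0 < s → HasLaplaceAt V₂ s _ := fun s hs =>
    (hpL k s hs).temperedIntegral hl₂ hα₂.2 hs hp0
  have hrL : ∀ s, 0 < s → HasLaplaceAt r s _ := fun s hs =>
    (((hpL k s hs).sub (hpL (k - 1) s hs)).const_mul (-μ)).add ((hpL k s hs).const_mul Λ)
  -- A is chosen so that A' = Σ c_i (V_i' + l_i V_i), which is the left-hand side of the equation.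
  set A : ℝ → ℝ := fun t => c₁ * (V₁ t + l₁ * ∫ u in (0 : ℝ)..t, V₁ u)
    + c₂ * (V₂ t + l₂ * ∫ u in (0 : ℝ)..t, V₂ u) with hA
  have hA' : ∀ u, 0 < u → HasDerivAt A (c₁ * shiftedFracDeriv l₁ α₁ (p k) u
      + c₂ * shiftedFracDeriv l₂ α₂ (p k) u) u := fun u hu => by
    have h₁ := hasDerivAt_primitive (hV₁L 1 one_pos).1 hu (hV₁' u hu).continuousAt
    have h₂ := hasDerivAt_primitive (hV₂L 1 one_pos).1 hu (hV₂' u hu).continuousAt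
    convert! (((hV₁' u hu).fun_add (h₁.const_mul l₁)).const_mul c₁).fun_add
      (((hV₂' u hu).fun_add (h₂.const_mul l₂)).const_mul c₂) using 1
    ring
  have hr' : ∀ u, 0 < u → HasDerivAt (fun t => ∫ u in (0 : ℝ)..t, r u) (r u) u := fun u hu =>
    hasDerivAt_primitive (hrL 1 one_pos).1 hu (hrc u hu)
  have hAL : ∀ s, 0 < s → HasLaplaceAt A s _ := fun s hs =>
    (((hV₁L s hs).add (((hV₁L s hs).primitive hs).const_mul l₁)).const_mul c₁).add
      (((hV₂L s hs).add (((hV₂L s hs).primitive hs).const_mul l₂)).const_mul c₂)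
  have hAr : ∀ u, 0 < u → A u = ∫ v in (0 : ℝ)..u, r v := fun u hu => by
    refine eq_of_hasLaplaceAt (b := 1) (fun s hs => hAL s (by linarith)) (fun s hs => ?_) hu
      (hA' u hu).continuousAt (hr' u hu).continuousAt
    have hs : 0 < s := by linarith
    convert! (hrL s hs).primitive hs using 1
    have hφ := laplaceExponent_nonneg hc₁ hc₂ hα₁ hα₂ hl₁ hl₂ hs.le
    have e₁ : (s + l₁) ^ α₁ = (s + l₁) ^ (α₁ - 1) * (s + l₁) := by
      rw [← Real.rpow_add_one (by linarith), sub_add_cancel]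
    have e₂ : (s + l₂) ^ α₂ = (s + l₂) ^ (α₂ - 1) * (s + l₂) := by
      rw [← Real.rpow_add_one (by linarith), sub_add_cancel]
    obtain ⟨n, rfl⟩ : ∃ n, k = n + 1 := ⟨k - 1, by omega⟩
    rw [Nat.add_sub_cancel]
    set ρ := μ / (μ + laplaceExponent c₁ c₂ α₁ α₂ l₁ l₂ s) with hρ
    -- The whole equation in transform space: Σ c_i (s + l_i)^α_i - Λ = φ(s), hence ρ (μ + φ) = μ.
    have hρμ : ρ * (μ + (c₁ * ((s + l₁) ^ (α₁ - 1) * (s + l₁))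
        + c₂ * ((s + l₂) ^ (α₂ - 1) * (s + l₂)) - Λ)) = μ := by
      have h1 : c₁ * ((s + l₁) ^ (α₁ - 1) * (s + l₁))
          + c₂ * ((s + l₂) ^ (α₂ - 1) * (s + l₂)) - Λ
          = laplaceExponent c₁ c₂ α₁ α₂ l₁ l₂ s := by
        rw [← e₁, ← e₂, hΛ, laplaceExponent]; ring
      rw [h1, hρ]
      field_simp
    field_simp
    linear_combination (ρ ^ n * (1 - ρ)) * hρμ
  have hfin : HasDerivAt A (r t) t := by
    refine (hr' t ht).congr_of_eventuallyEq ?_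
    filter_upwards [lt_mem_nhds ht] with u hu using hAr u hu
  exact (hA' t ht).unique hfin

end
/-! ### Poisson probabilities and tails -/

lemma poissonProb_nonneg {μ x : ℝ} (hμ : 0 ≤ μ) (hx : 0 ≤ x) (k : ℕ) : 0 ≤ poissonProb μ k x := by
  unfold poissonProb; positivity

lemma continuous_poissonProb (μ : ℝ) (k : ℕ) : Continuous (poissonProb μ k) := by
  unfold poissonProb; fun_prop

lemma sum_poissonProb_le_one {μ x : ℝ} (hμ : 0 ≤ μ) (hx : 0 ≤ x) (k : ℕ) :
    ∑ j ∈ Finset.range k, poissonProb μ j x ≤ 1 := by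
  have h := Real.sum_le_exp_of_nonneg (mul_nonneg hμ hx) k
  simp only [poissonProb, mul_div_assoc, ← Finset.mul_sum]
  rw [Real.exp_neg, inv_mul_le_iff₀ (Real.exp_pos _), mul_one]
  exact h

lemma poissonProb_le_one {μ x : ℝ} (hμ : 0 ≤ μ) (hx : 0 ≤ x) (k : ℕ) : poissonProb μ k x ≤ 1 :=
  (Finset.single_le_sum (f := fun j => poissonProb μ j x)
    (fun j _ => poissonProb_nonneg hμ hx j) (Finset.self_mem_range_succ k)).trans
    (sum_poissonProb_le_one hμ hx (k + 1))

lemma hasDerivAt_poissonProb_zero (μ x : ℝ) :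
    HasDerivAt (poissonProb μ 0) (-μ * poissonProb μ 0 x) x := by
  have h := ((hasDerivAt_id x).const_mul μ).fun_neg.exp
  have e : poissonProb μ 0 = fun x => Real.exp (-(μ * x)) := by
    ext x; simp [poissonProb]
  rw [e]
  convert! h using 1
  simp only [id]
  ring

lemma hasDerivAt_poissonProb_succ (μ x : ℝ) (k : ℕ) :
    HasDerivAt (poissonProb μ (k + 1)) (μ * (poissonProb μ k x - poissonProb μ (k + 1) x)) x := by
  have h1 := (hasDerivAt_id x).const_mul μ
  have h := (h1.fun_neg.exp.mul (h1.fun_pow (k + 1))).div_const ((k + 1).factorial : ℝ)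
  convert! h using 1
  simp only [poissonProb, id, Nat.factorial_succ, Nat.add_sub_cancel]
  push_cast
  have : (k.factorial : ℝ) ≠ 0 := by positivity
  have : (k : ℝ) + 1 ≠ 0 := by positivity
  field_simp
  ring

/-- The probability that a Poisson variable of parameter `μ x` is at least `k`. -/
noncomputable def poissonTail (μ : ℝ) (k : ℕ) (x : ℝ) : ℝ :=
  1 - ∑ j ∈ Finset.range k, poissonProb μ j x

lemma poissonTail_succ (μ : ℝ) (k : ℕ) (x : ℝ) :
    poissonTail μ (k + 1) x = poissonTail μ k x - poissonProb μ k x := by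
  rw [poissonTail, poissonTail, Finset.sum_range_succ]; ring

lemma continuous_poissonTail (μ : ℝ) (k : ℕ) : Continuous (poissonTail μ k) := by
  unfold poissonTail
  exact continuous_const.sub (continuous_finsetSum _ fun j _ => continuous_poissonProb μ j)

lemma poissonTail_nonneg {μ x : ℝ} (hμ : 0 ≤ μ) (hx : 0 ≤ x) (k : ℕ) : 0 ≤ poissonTail μ k x :=
  sub_nonneg.mpr (sum_poissonProb_le_one hμ hx k)

lemma poissonTail_le_one {μ x : ℝ} (hμ : 0 ≤ μ) (hx : 0 ≤ x) (k : ℕ) : poissonTail μ k x ≤ 1 :=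
  sub_le_self _ (Finset.sum_nonneg fun j _ => poissonProb_nonneg hμ hx j)

/-- The derivatives μ (p_{j-1} - p_j) telescope, leaving the Erlang density of the (k+1)-st arrival
time. -/
lemma hasDerivAt_poissonTail (μ x : ℝ) (k : ℕ) :
    HasDerivAt (poissonTail μ (k + 1)) (μ * poissonProb μ k x) x := by
  induction k with
  | zero =>
    have h := (hasDerivAt_poissonProb_zero μ x).const_sub 1
    have e : poissonTail μ (0 + 1) = fun x => 1 - poissonProb μ 0 x := by
      ext x; simp [poissonTail]
    rw [e]
    convert! h using 1
    ring
  | succ k ih =>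
    rw [funext (poissonTail_succ μ (k + 1))]
    convert! ih.fun_sub (hasDerivAt_poissonProb_succ μ x k) using 1
    ring

lemma poissonTail_zero (μ : ℝ) (k : ℕ) : poissonTail μ (k + 1) 0 = 0 := by
  rw [poissonTail, Finset.sum_range_succ', Finset.sum_eq_zero]
  · simp [poissonProb]
  · intro j _; simp [poissonProb]

lemma poissonTail_eq_integral (μ x : ℝ) (k : ℕ) :
    poissonTail μ (k + 1) x = ∫ y in (0 : ℝ)..x, μ * poissonProb μ k y := by
  rw [intervalIntegral.integral_eq_sub_of_hasDerivAt
    (fun y _ => hasDerivAt_poissonTail μ y k)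
    ((continuous_const.mul (continuous_poissonProb μ k)).intervalIntegrable _ _),
    poissonTail_zero, sub_zero]

lemma poissonTail_mono {μ x y : ℝ} (hμ : 0 ≤ μ) (hx : 0 ≤ x) (hxy : x ≤ y) (k : ℕ) :
    poissonTail μ k x ≤ poissonTail μ k y := by
  cases k with
  | zero => simp [poissonTail]
  | succ k =>
    refine monotoneOn_of_deriv_nonneg (convex_Ici 0)
      (continuous_poissonTail μ (k + 1)).continuousOn
      (fun z _ => (hasDerivAt_poissonTail μ z k).differentiableAt.differentiableWithinAt)
      (fun z hz => ?_) hx (hx.trans hxy) hxy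
    rw [interior_Ici] at hz
    rw [(hasDerivAt_poissonTail μ z k).deriv]
    exact mul_nonneg hμ (poissonProb_nonneg hμ (le_of_lt hz) k)

/-- The indicator moves the dependence on x out of the integration bounds, the form Tonelli needs
when x = E(t). -/
lemma lintegral_poissonProb_indicator {μ x : ℝ} (hμ : 0 ≤ μ) (hx : 0 ≤ x) (k : ℕ) :
    ∫⁻ y in Set.Ioi 0, ENNReal.ofReal (μ * poissonProb μ k y) * (Set.Iio x).indicator 1 y
      = ENNReal.ofReal (poissonTail μ (k + 1) x) := by
  have h1 : ∀ y, ENNReal.ofReal (μ * poissonProb μ k y) * (Set.Iio x).indicator 1 y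
      = (Set.Iio x).indicator (fun y => ENNReal.ofReal (μ * poissonProb μ k y)) y := fun y => by
    by_cases hy : y ∈ Set.Iio x <;> simp [hy]
  simp_rw [h1]
  rw [lintegral_indicator measurableSet_Iio, Measure.restrict_restrict measurableSet_Iio,
    poissonTail_eq_integral, intervalIntegral.integral_of_le hx, integral_Ioc_eq_integral_Ioo,
    Set.inter_comm, Set.Ioi_inter_Iio]
  refine (ofReal_integral_eq_lintegral_ofReal ?_ ?_).symm
  · exact ((continuous_const.mul (continuous_poissonProb μ k)).integrableOn_Icc (a := 0)
      (b := x)).mono_set Set.Ioo_subset_Icc_self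
  · filter_upwards [ae_restrict_mem measurableSet_Ioo] with y hy
    exact mul_nonneg hμ (poissonProb_nonneg hμ hy.1.le k)

/-- The Laplace transform at φ of an Erlang density: a Gamma integral with rate μ + φ. -/
lemma lintegral_poissonProb_mul_exp {μ φ : ℝ} (hμ : 0 < μ) (hφ : 0 ≤ φ) (k : ℕ) :
    ∫⁻ y in Set.Ioi 0, ENNReal.ofReal (μ * poissonProb μ k y * Real.exp (-(y * φ)))
      = ENNReal.ofReal ((μ / (μ + φ)) ^ (k + 1)) := by
  have h1 := Real.integral_rpow_mul_exp_neg_mul_Ioi (a := (k : ℝ) + 1) (r := μ + φ)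
    (by positivity) (by positivity)
  have hk : (k.factorial : ℝ) ≠ 0 := by positivity
  rw [Real.Gamma_nat_eq_factorial, add_sub_cancel_right] at h1
  have hne : (1 / (μ + φ)) ^ ((k : ℝ) + 1) * (k.factorial : ℝ) ≠ 0 := by positivity
  have h2 : IntegrableOn (fun t : ℝ => t ^ (k : ℝ) * Real.exp (-((μ + φ) * t)))
      (Set.Ioi 0) := by
    by_contra hcon
    rw [integral_undef hcon] at h1
    exact hne h1.symm
  have heq : (fun y => μ * poissonProb μ k y * Real.exp (-(y * φ)))
      = fun y => (μ ^ (k + 1) / k.factorial) * (y ^ (k : ℝ) * Real.exp (-((μ + φ) * y))) := by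
    ext y
    have : Real.exp (-((μ + φ) * y)) = Real.exp (-(μ * y)) * Real.exp (-(y * φ)) := by
      rw [← Real.exp_add]; ring_nf
    rw [this, poissonProb, Real.rpow_natCast, mul_pow]
    ring
  rw [← ofReal_integral_eq_lintegral_ofReal, heq, integral_const_mul, h1]
  · congr 1
    rw [← Nat.cast_succ, Real.rpow_natCast, one_div, inv_pow, div_pow]
    field_simp
  · rw [heq]; exact h2.const_mul _
  · filter_upwards [ae_restrict_mem measurableSet_Ioi] with y hy
    exact mul_nonneg (mul_nonneg hμ.le (poissonProb_nonneg hμ.le (le_of_lt hy) k))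
      (Real.exp_pos _).le

/-! ### The inverse of a path -/

/-- The right continuous inverse of a path. -/
noncomputable def pathInverse (t : ℝ) (x : ℝ≥0 → ℝ) : ℝ≥0 :=
  sInf {u : ℝ≥0 | 0 < u ∧ t < x u}

/-- The first point of the grid `ℕ / (n + 1)`, as an index, at which the path exceeds `t`. -/
noncomputable def firstIndex (n : ℕ) (t : ℝ) (x : ℝ≥0 → ℝ) : ℕ :=
  sInf {j : ℕ | t < x (j / (n + 1))}

/-- A path that is nondecreasing and unbounded above. -/
def IsUnboundedMonotone (x : ℝ≥0 → ℝ) : Prop :=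
  Monotone x ∧ ∀ t, ∃ u, t < x u

namespace IsUnboundedMonotone

variable {x : ℝ≥0 → ℝ}

lemma nonempty (hx : IsUnboundedMonotone x) (t : ℝ) : {u : ℝ≥0 | 0 < u ∧ t < x u}.Nonempty := by
  obtain ⟨u, hu⟩ := hx.2 t
  exact ⟨u + 1, by positivity, hu.trans_le (hx.1 (by simp))⟩

lemma pathInverse_mono (hx : IsUnboundedMonotone x) : Monotone fun t => pathInverse t x :=
  fun _ t' h => csInf_le_csInf (OrderBot.bddBelow _) (hx.nonempty t')
    fun _ hu => ⟨hu.1, h.trans_lt hu.2⟩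

lemma le_pathInverse (hx : IsUnboundedMonotone x) {t : ℝ} {u : ℝ≥0} (hu : x u ≤ t) :
    u ≤ pathInverse t x :=
  le_csInf (hx.nonempty t) fun v hv => by
    by_contra! h
    exact absurd (hx.1 h.le) (by linarith [hv.2])

lemma le_of_lt_pathInverse {t : ℝ} {u : ℝ≥0} (hu0 : 0 < u) (hu : u < pathInverse t x) :
    x u ≤ t := by
  by_contra! h
  exact hu.not_ge (csInf_le (OrderBot.bddBelow _) ⟨hu0, h⟩)

/-- Rational witnesses turn {y < E(t)} into a countable union, which gives joint measurability in
(t, ω, y). -/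
lemma lt_pathInverse_iff (hx : IsUnboundedMonotone x) {t y : ℝ} (hy : 0 < y) :
    y < pathInverse t x ↔ ∃ q : ℚ, y < q ∧ x (q : ℝ).toNNReal ≤ t := by
  constructor
  · intro h
    obtain ⟨q, hq1, hq2⟩ := exists_rat_btwn h
    have hq0 : (0 : ℝ) < q := hy.trans hq1
    refine ⟨q, hq1, le_of_lt_pathInverse (Real.toNNReal_pos.mpr hq0) ?_⟩
    rw [← NNReal.coe_lt_coe, Real.coe_toNNReal _ hq0.le]
    exact hq2
  · rintro ⟨q, hq1, hq2⟩
    have h := hx.le_pathInverse hq2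
    rw [← NNReal.coe_le_coe, Real.coe_toNNReal _ (hy.trans hq1).le] at h
    exact hq1.trans_le h

lemma firstIndex_spec (hx : IsUnboundedMonotone x) (n : ℕ) (t : ℝ) :
    t < x (firstIndex n t x / (n + 1)) := by
  obtain ⟨u, hu⟩ := hx.2 t
  obtain ⟨j, hj⟩ := exists_nat_ge (u * (n + 1))
  refine Nat.sInf_mem (s := {j : ℕ | t < x (j / (n + 1))}) ⟨j, hu.trans_le (hx.1 ?_)⟩
  rw [le_div_iff₀ (by positivity)]
  exact hj

lemma pathInverse_le_firstIndex (hx : IsUnboundedMonotone x) (n : ℕ) (t : ℝ) :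
    pathInverse t x ≤ firstIndex n t x / (n + 1) := by
  have h := hx.firstIndex_spec n t
  -- The infimum runs over u > 0 while the first grid index may be 0, so points strictly above the
  -- grid point are used.
  refine le_of_forall_gt_imp_ge_of_dense fun u hu => ?_
  exact csInf_le (OrderBot.bddBelow _) ⟨pos_of_gt hu, h.trans_le (hx.1 hu.le)⟩

lemma firstIndex_le (hx : IsUnboundedMonotone x) (n : ℕ) (t : ℝ) :
    (firstIndex n t x / (n + 1) : ℝ≥0) ≤ pathInverse t x + 1 / (n + 1) := by
  rcases Nat.eq_zero_or_pos (firstIndex n t x) with h | h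
  · simp [h]
  · obtain ⟨j, hj⟩ : ∃ j, firstIndex n t x = j + 1 := ⟨firstIndex n t x - 1, by omega⟩
    have h1 : ¬ t < x (j / (n + 1)) := Nat.notMem_of_lt_sInf (s := {j : ℕ | t < x (j / (n + 1))})
      (by change j < firstIndex n t x; omega)
    have h2 := hx.le_pathInverse (not_lt.mp h1)
    rw [hj]
    push_cast
    rw [add_div]
    gcongr

lemma tendsto_firstIndex (hx : IsUnboundedMonotone x) (t : ℝ) :
    Tendsto (fun n : ℕ => (firstIndex n t x / (n + 1) : ℝ≥0)) atTop (𝓝 (pathInverse t x)) := by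
  refine tendsto_of_tendsto_of_tendsto_of_le_of_le tendsto_const_nhds ?_
    (fun n => hx.pathInverse_le_firstIndex n t) (fun n => hx.firstIndex_le n t)
  have h : Tendsto (fun n : ℕ => (1 / ((n : ℝ≥0) + 1))) atTop (𝓝 0) :=
    tendsto_one_div_add_atTop_nhds_zero_nat
  simpa using h.const_add (pathInverse t x)

end IsUnboundedMonotone

lemma measurable_firstIndex (n : ℕ) (t : ℝ) : Measurable (firstIndex n t) := by
  have hm : ∀ j : ℕ, MeasurableSet {x : ℝ≥0 → ℝ | t < x (j / (n + 1))} := fun j =>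
    measurableSet_lt measurable_const (measurable_pi_apply _)
  refine measurable_to_countable' fun j => ?_
  -- The second piece accounts for the default `sInf ∅ = 0` on paths that never exceed t on the
  -- grid.
  have : firstIndex n t ⁻¹' {j} =
      ({x | t < x (j / (n + 1))} ∩ ⋂ i : Fin j, {x | t < x ((i : ℕ) / (n + 1))}ᶜ)
      ∪ ({x | j = 0} ∩ ⋂ i : ℕ, {x | t < x (i / (n + 1))}ᶜ) := by
    ext x
    simp only [Set.mem_preimage, Set.mem_singleton_iff, Set.mem_union, Set.mem_inter_iff,
      Set.mem_ofPred_eq, Set.mem_iInter, Set.mem_compl_iff, Fin.forall_iff]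
    by_cases h : ∃ i : ℕ, t < x (i / (n + 1))
    · have h2 : ¬ ∀ i : ℕ, ¬ t < x (i / (n + 1)) := by push Not; simpa using h
      simp only [h2, and_false, or_false]
      rw [firstIndex, Nat.sInf_def (s := {j : ℕ | t < x (j / (n + 1))}) h]
      exact Nat.find_eq_iff h
    · have h2 : {j : ℕ | t < x (j / (n + 1))} = ∅ := by
        ext i; simpa using not_exists.mp h i
      rw [firstIndex, h2, Nat.sInf_empty]
      push Not at h
      simp [fun i => not_lt.mpr (h i), eq_comm]
  rw [this]
  refine ((hm j).inter (MeasurableSet.iInter fun i : Fin j => (hm i).compl)).union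
    ((MeasurableSet.const _).inter (MeasurableSet.iInter fun i => (hm i).compl))
/-! ### The time-changed process -/

section

variable {Ω : Type*} [MeasurableSpace Ω] {P : Measure Ω}

/-- Conditioning on the countably many values of J; in the application a j = P(A j) and the
hypothesis is independence. -/
lemma measure_randomIndex_mem {J : Ω → ℕ} (hJ : Measurable J) {A : ℕ → Set Ω}
    (hA : ∀ j, MeasurableSet (A j)) {a : ℕ → ENNReal}
    (h : ∀ j, P (J ⁻¹' {j} ∩ A j) = P (J ⁻¹' {j}) * a j) :
    P {ω | ω ∈ A (J ω)} = ∫⁻ ω, a (J ω) ∂P := by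
  have h1 : {ω | ω ∈ A (J ω)} = ⋃ j, J ⁻¹' {j} ∩ A j := by
    ext ω; simp
  rw [h1, measure_iUnion, ← lintegral_map (f := a) (measurable_from_nat) hJ, lintegral_countable']
  · refine tsum_congr fun j => ?_
    rw [h, Measure.map_apply hJ (measurableSet_singleton j), mul_comm]
  · intro i j hij
    refine Set.disjoint_left.mpr fun ω h1 h2 => hij ?_
    exact h1.1.symm.trans h2.1
  · exact fun j => (hJ (measurableSet_singleton j)).inter (hA j)

lemma measurableSet_randomIndex_mem {J : Ω → ℕ} (hJ : Measurable J) {A : ℕ → Set Ω}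
    (hA : ∀ j, MeasurableSet (A j)) : MeasurableSet {ω | ω ∈ A (J ω)} := by
  have h1 : {ω | ω ∈ A (J ω)} = ⋃ j, J ⁻¹' {j} ∩ A j := by
    ext ω; simp
  rw [h1]
  exact MeasurableSet.iUnion fun j => (hJ (measurableSet_singleton j)).inter (hA j)

lemma IsPoissonProcess.measurable {N : ℝ≥0 → Ω → ℕ} {μ : ℝ≥0} (hN : IsPoissonProcess N μ P)
    (t : ℝ≥0) : Measurable (N t) := by
  refine measurable_to_countable' fun k => ?_
  have h := hN.levy.measurable t (measurableSet_singleton (k : ℝ))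
  convert! h using 1
  ext ω
  simp

lemma IsPoissonProcess.measure_eq {N : ℝ≥0 → Ω → ℕ} {μ : ℝ≥0} (hN : IsPoissonProcess N μ P)
    (t : ℝ≥0) (k : ℕ) : P {ω | N t ω = k} = ENNReal.ofReal (poissonProb μ k t) := by
  have h := (hN.law t).map_eq
  have h2 : P {ω | N t ω = k} = (P.map (N t)) {k} := by
    rw [Measure.map_apply (hN.measurable t) (measurableSet_singleton k)]
    rfl
  rw [h2, h, poissonMeasure_singleton, poissonProb]
  push_cast
  rfl

lemma IsCadlag.tendsto_of_le {x : ℝ≥0 → ℝ} (hx : IsCadlag x) {u : ℕ → ℝ≥0} {a : ℝ≥0}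
    (hu : Tendsto u atTop (𝓝 a)) (hle : ∀ n, a ≤ u n) :
    Tendsto (fun n => x (u n)) atTop (𝓝 (x a)) := by
  have h1 : ContinuousWithinAt x (Set.Ici a) a := continuousWithinAt_Ioi_iff_Ici.mp (hx a).1
  exact h1.tendsto.comp (tendsto_nhdsWithin_iff.mpr ⟨hu, Eventually.of_forall hle⟩)

lemma eventually_eq_of_tendsto_natCast {u : ℕ → ℕ} {a : ℕ}
    (h : Tendsto (fun n => (u n : ℝ)) atTop (𝓝 a)) : ∀ᶠ n in atTop, u n = a := by
  have h1 : Tendsto u atTop (𝓝 a) :=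
    (Nat.isClosedEmbedding_coe_real.isEmbedding.tendsto_nhds_iff).mpr h
  rwa [nhds_discrete, tendsto_pure] at h1

lemma aemeasurable_inverseProcess {S : ℝ≥0 → Ω → ℝ} (hSm : ∀ t, Measurable (S t))
    (hS : ∀ᵐ ω ∂P, IsUnboundedMonotone fun u => S u ω) (t : ℝ) :
    AEMeasurable (inverseProcess S t) P := by
  refine aemeasurable_of_tendsto_metrizable_ae atTop
    (f := fun (n : ℕ) ω => (firstIndex n t (fun u => S u ω) / (n + 1) : ℝ≥0)) (fun n => ?_) ?_
  · exact ((measurable_from_nat (f := fun j : ℕ => (j / (n + 1) : ℝ≥0))).comp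
      ((measurable_firstIndex n t).comp (measurable_pi_lambda _ hSm))).aemeasurable
  · filter_upwards [hS] with ω hω using hω.tendsto_firstIndex t

/-- The tail probability `P(N(E(t)) ≥ k)`, written as a mixture of Poisson tails. -/
noncomputable def mixedTail (P : Measure Ω) (S : ℝ≥0 → Ω → ℝ) (μ : ℝ) (k : ℕ) (t : ℝ) : ℝ :=
  ∫ ω, poissonTail μ k (inverseProcess S t ω) ∂P

lemma mixedTail_nonneg {S : ℝ≥0 → Ω → ℝ} {μ : ℝ} (hμ : 0 ≤ μ) (k : ℕ) (t : ℝ) :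
    0 ≤ mixedTail P S μ k t :=
  integral_nonneg fun _ => poissonTail_nonneg hμ (NNReal.coe_nonneg _) k

variable [IsProbabilityMeasure P]

/-- The law of a Poisson process at an independent inverse time is a mixture of Poisson laws. -/
lemma timeChangedPMF_eq_integral {N : ℝ≥0 → Ω → ℕ} {S : ℝ≥0 → Ω → ℝ} {μ : ℝ≥0}
    (hN : IsPoissonProcess N μ P) (hSm : ∀ t, Measurable (S t))
    (hS : ∀ᵐ ω ∂P, IsUnboundedMonotone fun u => S u ω)
    (hNS : IndepFun (fun ω t => N t ω) (fun ω t => S t ω) P) (k : ℕ) (t : ℝ) :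
    timeChangedPMF N S P k t = ∫ ω, poissonProb μ k (inverseProcess S t ω) ∂P := by
  set J : ℕ → Ω → ℕ := fun n ω => firstIndex n t fun u => S u ω with hJ
  have hJm : ∀ n, Measurable (J n) := fun n =>
    (measurable_firstIndex n t).comp (measurable_pi_lambda _ hSm)
  have hAm : ∀ n j : ℕ, MeasurableSet {ω | N (j / (n + 1)) ω = k} := fun n j =>
    hN.measurable _ (measurableSet_singleton k)
  set A : ℕ → Set Ω := fun n => {ω | N (J n ω / (n + 1)) ω = k} with hA
  have hA1 : ∀ n, MeasurableSet (A n) := fun n =>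
    measurableSet_randomIndex_mem (A := fun j => {ω | N (j / (n + 1)) ω = k}) (hJm n) (hAm n)
  have hA2 : ∀ n, P (A n) = ∫⁻ ω, ENNReal.ofReal
      (poissonProb μ k ((J n ω / (n + 1) : ℝ≥0) : ℝ)) ∂P := fun n => by
    refine measure_randomIndex_mem (A := fun j => {ω | N (j / (n + 1)) ω = k})
      (a := fun j => ENNReal.ofReal (poissonProb μ k ((j / (n + 1) : ℝ≥0) : ℝ)))
      (hJm n) (hAm n) fun j => ?_
    have h1 := hNS.measure_inter_preimage_eq_mul {y | y (j / (n + 1)) = k}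
      (firstIndex n t ⁻¹' {j})
      (measurable_pi_apply (X := fun _ : ℝ≥0 => ℕ) (j / (n + 1) : ℝ≥0)
        (measurableSet_singleton k))
      (measurable_firstIndex n t (measurableSet_singleton j))
    rw [Set.inter_comm, mul_comm, ← hN.measure_eq]
    exact h1
  have hTm : ∀ n, Measurable fun ω => ((J n ω / (n + 1) : ℝ≥0) : ℝ) := fun n =>
    (measurable_from_nat (f := fun j : ℕ => ((j / (n + 1) : ℝ≥0) : ℝ))).comp (hJm n)
  have hA3 : ∀ n, (P (A n)).toReal = ∫ ω, poissonProb μ k ((J n ω / (n + 1) : ℝ≥0) : ℝ) ∂P :=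
    fun n => by
    rw [hA2, integral_eq_lintegral_of_nonneg_ae]
    · exact ae_of_all _ fun ω => poissonProb_nonneg μ.coe_nonneg (NNReal.coe_nonneg _) k
    · exact ((continuous_poissonProb μ k).measurable.comp (hTm n)).aestronglyMeasurable
  have hlim : ∀ᵐ ω ∂P, Tendsto (fun n => (J n ω / (n + 1) : ℝ≥0)) atTop
      (𝓝 (inverseProcess S t ω)) := by
    filter_upwards [hS] with ω hω using hω.tendsto_firstIndex t
  -- The grid times decrease to E(t) only in the weak sense of approaching it from above, which is
  -- enough for right continuity of N; integer values then make N at these times eventually equal to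
  -- N(E(t)).
  have hev : ∀ᵐ ω ∂P, ∀ᶠ n in atTop,
      (ω ∈ A n ↔ ω ∈ {ω | N (inverseProcess S t ω) ω = k}) := by
    filter_upwards [hS, hlim, hN.levy.cadlag] with ω hω hl hc
    have h1 := hc.tendsto_of_le hl fun n => hω.pathInverse_le_firstIndex n t
    filter_upwards [eventually_eq_of_tendsto_natCast h1] with n hn
    simp only [hA, Set.mem_ofPred_eq, hn]
  -- The event {N(E(t)) = k} is not known to be measurable; this lower limit of measurable events
  -- agrees with it almost everywhere.
  set A' : Set Ω := {ω | ∀ᶠ n in atTop, ω ∈ A n} with hA'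
  have hA'm : MeasurableSet A' := by
    have : A' = ⋃ n, ⋂ i, ⋂ (_ : n ≤ i), A i := by
      ext ω; simp [hA', eventually_atTop]
    rw [this]
    exact MeasurableSet.iUnion fun n => MeasurableSet.iInter fun i =>
      MeasurableSet.iInter fun _ => hA1 i
  have hev' : ∀ᵐ ω ∂P, (ω ∈ A' ↔ ω ∈ {ω | N (inverseProcess S t ω) ω = k}) := by
    filter_upwards [hev] with ω hω
    constructor
    · intro h
      obtain ⟨n, h1, h2⟩ := (hω.and (show ∀ᶠ n in atTop, ω ∈ A n from h)).exists
      exact h1.mp h2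
    · intro h
      exact hω.mono fun n hn => hn.mpr h
  have hPA : P {ω | N (inverseProcess S t ω) ω = k} = P A' :=
    measure_congr (hev'.mono fun ω hω => propext hω.symm)
  have ht1 : Tendsto (fun n => P (A n)) atTop (𝓝 (P A')) := by
    refine tendsto_measure_of_ae_tendsto_indicator_of_isFiniteMeasure atTop hA'm hA1 ?_
    filter_upwards [hev, hev'] with ω h1 h2
    exact h1.mono fun n hn => hn.trans h2.symm
  have ht2 : Tendsto (fun n => (P (A n)).toReal) atTop
      (𝓝 (∫ ω, poissonProb μ k (inverseProcess S t ω) ∂P)) := by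
    simp_rw [hA3]
    refine tendsto_integral_of_dominated_convergence (fun _ => 1) (fun n => ?_)
      (integrable_const _) (fun n => ae_of_all _ fun ω => ?_) ?_
    · exact ((continuous_poissonProb μ k).measurable.comp (hTm n)).aestronglyMeasurable
    · rw [Real.norm_of_nonneg (poissonProb_nonneg μ.coe_nonneg (NNReal.coe_nonneg _) k)]
      exact poissonProb_le_one μ.coe_nonneg (NNReal.coe_nonneg _) k
    · filter_upwards [hlim] with ω hω
      exact ((continuous_poissonProb μ k).comp NNReal.continuous_coe).continuousAt.tendsto.comp hω
  rw [timeChangedPMF, measureReal_def, hPA]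
  exact tendsto_nhds_unique ((ENNReal.tendsto_toReal (measure_ne_top _ _)).comp ht1) ht2

lemma integrable_comp_inverseProcess {S : ℝ≥0 → Ω → ℝ} (hSm : ∀ t, Measurable (S t))
    (hS : ∀ᵐ ω ∂P, IsUnboundedMonotone fun u => S u ω) (t : ℝ) {f : ℝ → ℝ} (hf : Continuous f)
    (hf0 : ∀ x, 0 ≤ x → 0 ≤ f x) (hf1 : ∀ x, 0 ≤ x → f x ≤ 1) :
    Integrable (fun ω => f (inverseProcess S t ω)) P := by
  refine Integrable.mono' (integrable_const (1 : ℝ)) ?_ (ae_of_all _ fun ω => ?_)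
  · exact ((hf.comp NNReal.continuous_coe).measurable.comp_aemeasurable
      (aemeasurable_inverseProcess hSm hS t)).aestronglyMeasurable
  · rw [Real.norm_of_nonneg (hf0 _ (NNReal.coe_nonneg _))]
    exact hf1 _ (NNReal.coe_nonneg _)

section

variable {S : ℝ≥0 → Ω → ℝ} {μ : ℝ}

lemma integrable_poissonTail (hSm : ∀ t, Measurable (S t))
    (hS : ∀ᵐ ω ∂P, IsUnboundedMonotone fun u => S u ω) (hμ : 0 ≤ μ) (k : ℕ) (t : ℝ) :
    Integrable (fun ω => poissonTail μ k (inverseProcess S t ω)) P :=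
  integrable_comp_inverseProcess hSm hS t (continuous_poissonTail μ k)
    (fun _ hx => poissonTail_nonneg hμ hx k) fun _ hx => poissonTail_le_one hμ hx k

lemma mixedTail_le_one (hSm : ∀ t, Measurable (S t))
    (hS : ∀ᵐ ω ∂P, IsUnboundedMonotone fun u => S u ω) (hμ : 0 ≤ μ) (k : ℕ) (t : ℝ) :
    mixedTail P S μ k t ≤ 1 := by
  have := integral_mono (integrable_poissonTail hSm hS hμ k t) (integrable_const (1 : ℝ))
    fun ω => poissonTail_le_one hμ (NNReal.coe_nonneg _) k
  simpa [mixedTail] using this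

lemma mixedTail_zero (t : ℝ) : mixedTail P S μ 0 t = 1 := by
  simp [mixedTail, poissonTail]

lemma monotone_mixedTail (hSm : ∀ t, Measurable (S t))
    (hS : ∀ᵐ ω ∂P, IsUnboundedMonotone fun u => S u ω) (hμ : 0 ≤ μ) (k : ℕ) :
    Monotone (mixedTail P S μ k) := fun t t' htt' => by
  refine integral_mono_ae (integrable_poissonTail hSm hS hμ k t)
    (integrable_poissonTail hSm hS hμ k t') ?_
  filter_upwards [hS] with ω hω
  exact poissonTail_mono hμ (NNReal.coe_nonneg _) (NNReal.coe_le_coe.mpr (hω.pathInverse_mono htt'))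
    k

lemma timeChangedPMF_eq_sub_mixedTail {N : ℝ≥0 → Ω → ℕ} {μ : ℝ≥0}
    (hN : IsPoissonProcess N μ P) (hSm : ∀ t, Measurable (S t))
    (hS : ∀ᵐ ω ∂P, IsUnboundedMonotone fun u => S u ω)
    (hNS : IndepFun (fun ω t => N t ω) (fun ω t => S t ω) P) (k : ℕ) (t : ℝ) :
    timeChangedPMF N S P k t = mixedTail P S μ k t - mixedTail P S μ (k + 1) t := by
  rw [timeChangedPMF_eq_integral hN hSm hS hNS, mixedTail, mixedTail,
    ← integral_sub (integrable_poissonTail hSm hS μ.coe_nonneg k t)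
      (integrable_poissonTail hSm hS μ.coe_nonneg (k + 1) t)]
  congr 1
  ext ω
  rw [poissonTail_succ]
  ring

end

end

/-! ### Laplace transforms of the tail probabilities -/

lemma lintegral_rotate {α β γ : Type*} [MeasurableSpace α] [MeasurableSpace β] [MeasurableSpace γ]
    {m₁ : Measure α} {m₂ : Measure β} {m₃ : Measure γ} [SFinite m₁] [SFinite m₂] [SFinite m₃]
    {f : α → β → γ → ENNReal} (hf : Measurable fun p : α × β × γ => f p.1 p.2.1 p.2.2) :
    ∫⁻ x, ∫⁻ y, ∫⁻ z, f x y z ∂m₃ ∂m₂ ∂m₁ = ∫⁻ z, ∫⁻ y, ∫⁻ x, f x y z ∂m₁ ∂m₂ ∂m₃ := by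
  calc ∫⁻ x, ∫⁻ y, ∫⁻ z, f x y z ∂m₃ ∂m₂ ∂m₁ = ∫⁻ x, ∫⁻ z, ∫⁻ y, f x y z ∂m₂ ∂m₃ ∂m₁ := by
        refine lintegral_congr fun x => lintegral_lintegral_swap ?_
        exact (hf.comp (measurable_const.prodMk measurable_id)).aemeasurable
    _ = ∫⁻ z, ∫⁻ x, ∫⁻ y, f x y z ∂m₂ ∂m₁ ∂m₃ := by
        refine lintegral_lintegral_swap (Measurable.aemeasurable ?_)
        have h : Measurable fun q : (α × γ) × β => f q.1.1 q.2 q.1.2 :=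
          hf.comp ((measurable_fst.comp measurable_fst).prodMk
            (measurable_snd.prodMk (measurable_snd.comp measurable_fst)))
        exact h.lintegral_prod_right'
    _ = _ := by
        refine lintegral_congr fun z => lintegral_lintegral_swap ?_
        exact (hf.comp (measurable_fst.prodMk
          (measurable_snd.prodMk measurable_const))).aemeasurable

lemma lintegral_Ioi_exp {s a : ℝ} (hs : 0 < s) :
    ∫⁻ t in Set.Ioi a, ENNReal.ofReal (Real.exp (-(s * t)))
      = ENNReal.ofReal (s⁻¹ * Real.exp (-(s * a))) := by
  rw [← ofReal_integral_eq_lintegral_ofReal]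
  · have := integral_exp_mul_Ioi (neg_lt_zero.mpr hs) a
    simp only [neg_mul] at this
    rw [this, neg_div_neg_eq, div_eq_inv_mul]
  · have h : IntegrableOn (fun t : ℝ => Real.exp (-(s * t))) (Set.Ioi a) := by
      simpa using exp_neg_integrableOn_Ioi a hs
    exact h
  · exact ae_of_all _ fun t => (Real.exp_pos _).le

/-- The occupation of `{t : y < E(t)}` under an exponential weight, for a right continuous path. -/
lemma lintegral_exp_mul_indicator_pathInverse {x : ℝ≥0 → ℝ} (hx : IsUnboundedMonotone x)
    (hc : IsCadlag x) (hx0 : x 0 = 0) {s y : ℝ} (hs : 0 < s) (hy : 0 < y) :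
    ∫⁻ t in Set.Ioi 0, ENNReal.ofReal (Real.exp (-(s * t)))
        * {t : ℝ | y < pathInverse t x}.indicator 1 t
      = ENNReal.ofReal (s⁻¹ * Real.exp (-(s * x y.toNNReal))) := by
  have hxy : 0 ≤ x y.toNNReal := hx0 ▸ hx.1 bot_le
  rw [← lintegral_Ioi_exp hs]
  -- Right continuity supplies u > y with x u < t, which makes the inequality y < E(t) strict.
  have h1 : ∀ t, x y.toNNReal < t → y < pathInverse t x := fun t ht => by
    have h2 := ((hc y.toNNReal).1.eventually (gt_mem_nhds ht)).and self_mem_nhdsWithin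
    obtain ⟨u, hu1, hu2⟩ := h2.exists
    have h3 := hx.le_pathInverse hu1.le
    have h4 : y.toNNReal < pathInverse t x := lt_of_lt_of_le hu2 h3
    rwa [← NNReal.coe_lt_coe, Real.coe_toNNReal _ hy.le] at h4
  have h2 : ∀ t, t < x y.toNNReal → ¬ y < pathInverse t x := fun t ht h => by
    have h3 := IsUnboundedMonotone.le_of_lt_pathInverse (x := x) (t := t) (u := y.toNNReal)
      (Real.toNNReal_pos.mpr hy) (by
        rwa [← NNReal.coe_lt_coe, Real.coe_toNNReal _ hy.le])
    linarith
  rw [← lintegral_indicator measurableSet_Ioi, ← lintegral_indicator measurableSet_Ioi]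
  refine lintegral_congr_ae ?_
  -- At t = x(y) either case may occur, for instance when the path is flat after y; a single point
  -- is negligible.
  have h3 : ∀ᵐ t : ℝ, t ≠ x y.toNNReal := by
    simp [ae_iff, measure_singleton]
  filter_upwards [h3] with t ht
  rcases lt_or_gt_of_ne ht with h | h
  · rw [Set.indicator_of_notMem (a := t) (s := Set.Ioi (x y.toNNReal)) (by simpa using h.le)]
    by_cases h0 : t ∈ Set.Ioi (0 : ℝ)
    · rw [Set.indicator_of_mem h0, Set.indicator_of_notMem (by exact h2 t h), mul_zero]
    · rw [Set.indicator_of_notMem h0]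
  · rw [Set.indicator_of_mem (a := t) (s := Set.Ioi (x y.toNNReal)) h,
      Set.indicator_of_mem (a := t) (s := Set.Ioi 0) (hxy.trans_lt h),
      Set.indicator_of_mem (by exact h1 t h)]
    simp

section

variable {Ω : Type*} [MeasurableSpace Ω] {P : Measure Ω}
  {S : ℝ≥0 → Ω → ℝ} {c₁ c₂ α₁ α₂ l₁ l₂ : ℝ}

lemma IsMTSS.integrable_exp (hS : IsMTSS S c₁ c₂ α₁ α₂ l₁ l₂ P) (t : ℝ≥0) {s : ℝ} (hs : 0 < s) :
    Integrable (fun ω => Real.exp (-(s * S t ω))) P := by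
  by_contra h
  have := hS.laplace t s hs
  rw [integral_undef h] at this
  exact (Real.exp_pos _).ne this

variable [IsProbabilityMeasure P]

/-- Markov's inequality for exp(-s S(n)) bounds the probability that S stays below T on the integers
by exp(sT - n φ(s)), which tends to 0 once φ(s) > 0. -/
lemma IsMTSS.ae_isUnboundedMonotone (hS : IsMTSS S c₁ c₂ α₁ α₂ l₁ l₂ P)
    (hφ : ∃ s > 0, 0 < laplaceExponent c₁ c₂ α₁ α₂ l₁ l₂ s) :
    ∀ᵐ ω ∂P, IsUnboundedMonotone fun u => S u ω := by
  obtain ⟨s, hs, hφ⟩ := hφ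
  set φ := laplaceExponent c₁ c₂ α₁ α₂ l₁ l₂ s
  have h : ∀ T : ℕ, ∀ᵐ ω ∂P, ∃ n : ℕ, (T : ℝ) < S n ω := fun T => by
    have h1 : ∀ n : ℕ, P.real {ω | ∀ n : ℕ, S n ω ≤ T}
        ≤ Real.exp (s * T) * Real.exp (-(φ * n)) := fun n => by
      have h2 := mul_meas_ge_le_integral_of_nonneg
        (ae_of_all P fun ω => (Real.exp_pos (-(s * S n ω))).le) (hS.integrable_exp n hs)
        (Real.exp (-(s * T)))
      rw [hS.laplace n s hs, Real.exp_neg (s * T), inv_mul_le_iff₀ (Real.exp_pos _)] at h2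
      refine (measureReal_mono fun ω hω => ?_).trans (h2.trans (le_of_eq ?_))
      · change (Real.exp (s * T))⁻¹ ≤ Real.exp (-(s * S n ω))
        rw [← Real.exp_neg]
        exact Real.exp_le_exp.mpr (neg_le_neg (mul_le_mul_of_nonneg_left (hω n) hs.le))
      · rw [mul_comm φ]; rfl
    have h3 : Tendsto (fun n : ℕ => Real.exp (s * T) * Real.exp (-(φ * n))) atTop (𝓝 0) := by
      have := (Real.tendsto_exp_neg_atTop_nhds_zero.comp
        (tendsto_natCast_atTop_atTop.const_mul_atTop hφ)).const_mul (Real.exp (s * T))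
      rwa [mul_zero] at this
    have h4 : P.real {ω | ∀ n : ℕ, S n ω ≤ T} = 0 :=
      le_antisymm (ge_of_tendsto' h3 h1) measureReal_nonneg
    rw [ae_iff]
    push Not
    exact (measureReal_eq_zero_iff).mp h4
  filter_upwards [ae_all_iff.mpr h, hS.monotone] with ω h1 h2
  refine ⟨h2, fun t => ?_⟩
  obtain ⟨T, hT⟩ := exists_nat_ge t
  obtain ⟨n, hn⟩ := h1 T
  exact ⟨n, hT.trans_lt hn⟩

/-- Tonelli in (t, ω, y): the t-integral gives s⁻¹ exp(-s S(y)), the expectation s⁻¹ exp(-y φ), and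
the y-integral against the Erlang density the power of μ / (μ + φ). Everything is nonnegative. -/
lemma IsMTSS.lintegral_mixedTail {μ : ℝ} (hS : IsMTSS S c₁ c₂ α₁ α₂ l₁ l₂ P)
    (hSu : ∀ᵐ ω ∂P, IsUnboundedMonotone fun u => S u ω) (hμ : 0 < μ) (k : ℕ) {s : ℝ} (hs : 0 < s)
    (hφ : 0 ≤ laplaceExponent c₁ c₂ α₁ α₂ l₁ l₂ s) :
    ∫⁻ t in Set.Ioi 0, ENNReal.ofReal (Real.exp (-(s * t)) * mixedTail P S μ (k + 1) t)
      = ENNReal.ofReal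
        (s⁻¹ * (μ / (μ + laplaceExponent c₁ c₂ α₁ α₂ l₁ l₂ s)) ^ (k + 1)) := by
  set φ := laplaceExponent c₁ c₂ α₁ α₂ l₁ l₂ s with hφdef
  set e : ℝ → ENNReal := fun t => ENNReal.ofReal (Real.exp (-(s * t))) with he
  set w : ℝ → ENNReal := fun y => ENNReal.ofReal (μ * poissonProb μ k y) with hw
  have hem : Measurable e :=
    (by fun_prop : Measurable fun t : ℝ => Real.exp (-(s * t))).ennreal_ofReal
  have hwm : Measurable w :=
    ((continuous_const.mul (continuous_poissonProb μ k)).measurable).ennreal_ofReal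
  set A : Set (ℝ × Ω × ℝ) :=
    {p | ∃ q : ℚ, p.2.2 < q ∧ S (q : ℝ).toNNReal p.2.1 ≤ p.1} with hA
  have hAm : MeasurableSet A := by
    have : A = ⋃ q : ℚ,
        ({p : ℝ × Ω × ℝ | p.2.2 < (q : ℝ)} ∩ {p | S (q : ℝ).toNNReal p.2.1 ≤ p.1}) := by
      ext p; simp [hA]
    rw [this]
    refine MeasurableSet.iUnion fun q => MeasurableSet.inter ?_ ?_
    · exact measurableSet_lt (by fun_prop) measurable_const
    · exact measurableSet_le ((hS.measurable _).comp (measurable_fst.comp measurable_snd))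
        measurable_fst
  have hAiff : ∀ ω, IsUnboundedMonotone (fun u => S u ω) → ∀ t y, 0 < y →
      A.indicator (1 : ℝ × Ω × ℝ → ENNReal) (t, ω, y)
        = {t : ℝ | y < pathInverse t fun u => S u ω}.indicator 1 t := fun ω hω t y hy => by
    have h1 : (t, ω, y) ∈ A ↔ t ∈ {t : ℝ | y < pathInverse t fun u => S u ω} :=
      (hω.lt_pathInverse_iff hy).symm
    by_cases h : (t, ω, y) ∈ A
    · rw [Set.indicator_of_mem h, Set.indicator_of_mem (h1.mp h)]; rfl
    · rw [Set.indicator_of_notMem h, Set.indicator_of_notMem (fun h' => h (h1.mpr h'))]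
  have step1 : ∀ t, ENNReal.ofReal (Real.exp (-(s * t)) * mixedTail P S μ (k + 1) t)
      = ∫⁻ ω, (∫⁻ y in Set.Ioi 0, e t * (w y * A.indicator 1 (t, ω, y))) ∂P := fun t => by
    rw [ENNReal.ofReal_mul (Real.exp_pos _).le, mixedTail,
      ofReal_integral_eq_lintegral_ofReal (integrable_poissonTail hS.measurable hSu hμ.le _ t)
        (ae_of_all _ fun ω => poissonTail_nonneg hμ.le (NNReal.coe_nonneg _) _),
      ← lintegral_const_mul' _ _ ENNReal.ofReal_ne_top]
    refine lintegral_congr_ae ?_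
    filter_upwards [hSu] with ω hω
    rw [lintegral_const_mul' _ _ ENNReal.ofReal_ne_top,
      ← lintegral_poissonProb_indicator hμ.le (NNReal.coe_nonneg _)]
    congr 1
    refine setLIntegral_congr_fun measurableSet_Ioi fun y hy => ?_
    simp only [hAiff ω hω t y hy]
    rfl
  simp_rw [step1]
  rw [lintegral_rotate (f := fun t ω y => e t * (w y * A.indicator 1 (t, ω, y)))]
  · have step2 : ∀ y ∈ Set.Ioi (0 : ℝ),
        ∫⁻ ω, (∫⁻ t in Set.Ioi 0, e t * (w y * A.indicator 1 (t, ω, y))) ∂P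
          = ENNReal.ofReal s⁻¹ * ENNReal.ofReal (μ * poissonProb μ k y * Real.exp (-(y * φ))) :=
      fun y hy => by
      have hy : 0 < y := hy
      have h1 : ∀ᵐ ω ∂P, ∫⁻ t in Set.Ioi 0, e t * (w y * A.indicator 1 (t, ω, y))
          = w y * ENNReal.ofReal (s⁻¹ * Real.exp (-(s * S y.toNNReal ω))) := by
        filter_upwards [hSu, hS.cadlag, hS.zero] with ω h1 h2 h3
        rw [← lintegral_exp_mul_indicator_pathInverse h1 h2 h3 hs hy,
          ← lintegral_const_mul' _ _ ENNReal.ofReal_ne_top]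
        refine lintegral_congr fun t => ?_
        rw [hAiff ω h1 t y hy, mul_left_comm]
      rw [lintegral_congr_ae h1, lintegral_const_mul' _ _ ENNReal.ofReal_ne_top,
        ← ofReal_integral_eq_lintegral_ofReal ((hS.integrable_exp _ hs).const_mul _)
          (ae_of_all _ fun ω => by positivity), integral_const_mul, hS.laplace _ s hs,
        Real.coe_toNNReal _ hy.le, ← ENNReal.ofReal_mul, ← ENNReal.ofReal_mul]
      · congr 1; ring
      · positivity
      · exact mul_nonneg hμ.le (poissonProb_nonneg hμ.le hy.le k)
    rw [setLIntegral_congr_fun measurableSet_Ioi step2,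
      lintegral_const_mul' _ _ ENNReal.ofReal_ne_top, lintegral_poissonProb_mul_exp hμ hφ,
      ← ENNReal.ofReal_mul (by positivity)]
  · exact (hem.comp measurable_fst).mul ((hwm.comp (measurable_snd.comp measurable_snd)).mul
      (measurable_one.indicator hAm))

lemma IsMTSS.hasLaplaceAt_mixedTail {μ : ℝ} (hS : IsMTSS S c₁ c₂ α₁ α₂ l₁ l₂ P)
    (hSu : ∀ᵐ ω ∂P, IsUnboundedMonotone fun u => S u ω) (hμ : 0 < μ) (k : ℕ) {s : ℝ} (hs : 0 < s)
    (hφ : 0 ≤ laplaceExponent c₁ c₂ α₁ α₂ l₁ l₂ s) :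
    HasLaplaceAt (mixedTail P S μ k) s
      (s⁻¹ * (μ / (μ + laplaceExponent c₁ c₂ α₁ α₂ l₁ l₂ s)) ^ k) := by
  have hI : IntegrableOn (fun t => Real.exp (-(s * t)) * mixedTail P S μ k t) (Set.Ioi 0) := by
    refine integrableOn_exp_mul_of_bounded (C := 1)
      (monotone_mixedTail hS.measurable hSu hμ.le k).measurable.aestronglyMeasurable
      (fun t _ => ?_) hs
    rw [abs_of_nonneg (mixedTail_nonneg hμ.le k t)]
    exact mixedTail_le_one hS.measurable hSu hμ.le k t
  refine ⟨hI, ?_⟩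
  cases k with
  | zero =>
    have := integral_exp_mul_Ioi (neg_lt_zero.mpr hs) 0
    simpa [mixedTail_zero, neg_div_neg_eq] using this
  | succ k =>
    rw [integral_eq_lintegral_of_nonneg_ae
      (ae_of_all _ fun t => mul_nonneg (Real.exp_pos _).le (mixedTail_nonneg hμ.le _ t))
      hI.aestronglyMeasurable, hS.lintegral_mixedTail hSu hμ k hs hφ, ENNReal.toReal_ofReal]
    positivity

end

/-! ### Vanishing source terms and the governing equation -/

lemma sourceTerm_poissonProb (α l t μ : ℝ) {k : ℕ} (hk : 1 ≤ k) :
    sourceTerm α l t (poissonProb μ k) = 0 := by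
  rw [sourceTerm, integral_dirac]
  simp [poissonProb, show k ≠ 0 by omega]

end MTTFPP

open MTTFPP in
theorem proposition5p2 {Ω : Type*} [MeasurableSpace Ω] (P : Measure Ω) [IsProbabilityMeasure P]
    (c₁ c₂ α₁ α₂ l₁ l₂ : ℝ) (μ : ℝ≥0)
    (hc₁ : 0 ≤ c₁) (hc₂ : 0 ≤ c₂) (hc : c₁ + c₂ = 1)
    (hα₁ : α₁ ∈ Set.Ioo (0 : ℝ) 1) (hα₂ : α₂ ∈ Set.Ioo (0 : ℝ) 1)
    (hl₁ : 0 ≤ l₁) (hl₂ : 0 ≤ l₂) (hμ : 0 < μ)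
    (N : ℝ≥0 → Ω → ℕ) (S : ℝ≥0 → Ω → ℝ)
    (hN : MTTFPP.IsPoissonProcess N μ P)
    (hS : MTTFPP.IsMTSS S c₁ c₂ α₁ α₂ l₁ l₂ P)
    (hNS : IndepFun (fun ω t => N t ω) (fun ω t => S t ω) P)
    (k : ℕ) (hk : 1 ≤ k) (t : ℝ) (ht : 0 < t) :
    MTTFPP.ShiftedFracDifferentiableAt l₁ α₁ (MTTFPP.timeChangedPMF N S P k) t ∧
    MTTFPP.ShiftedFracDifferentiableAt l₂ α₂ (MTTFPP.timeChangedPMF N S P k) t ∧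
    c₁ * MTTFPP.shiftedFracDeriv l₁ α₁ (MTTFPP.timeChangedPMF N S P k) t
      + c₂ * MTTFPP.shiftedFracDeriv l₂ α₂ (MTTFPP.timeChangedPMF N S P k) t
    = -(μ : ℝ) * (MTTFPP.timeChangedPMF N S P k t - MTTFPP.timeChangedPMF N S P (k - 1) t)
      + (c₁ * l₁ ^ α₁ + c₂ * l₂ ^ α₂) * MTTFPP.timeChangedPMF N S P k t
      - c₁ * MTTFPP.sourceTerm α₁ l₁ t (MTTFPP.poissonProb μ k)
      - c₂ * MTTFPP.sourceTerm α₂ l₂ t (MTTFPP.poissonProb μ k) := by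
  have hSu := hS.ae_isUnboundedMonotone (laplaceExponent_pos hc₁ hc₂ hc hα₁ hα₂ hl₁ hl₂)
  have hμ' : (0 : ℝ) < μ := hμ
  rw [sourceTerm_poissonProb _ _ _ _ hk, sourceTerm_poissonProb _ _ _ _ hk, mul_zero, mul_zero,
    sub_zero, sub_zero]
  exact governing_equation_of_tails (Q := mixedTail P S μ) hc₁ hc₂ hc hα₁ hα₂ hl₁ hl₂ hμ'
    (fun m => monotone_mixedTail hS.measurable hSu hμ'.le m)
    (fun m t => mixedTail_nonneg hμ'.le m t)
    (fun m t => mixedTail_le_one hS.measurable hSu hμ'.le m t) mixedTail_zero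
    (fun m s hs => hS.hasLaplaceAt_mixedTail hSu hμ' m hs
      (laplaceExponent_nonneg hc₁ hc₂ hα₁ hα₂ hl₁ hl₂ hs.le))
    (timeChangedPMF_eq_sub_mixedTail hN hS.measurable hSu hNS) hk ht
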